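/- Let $n\ge 3$ and let $\mathbb{R}_n$ be the real Clifford algebra generated by $e_1,\dots,e_n$ with $e_i^2=-1$, $e_ie_j=-e_je_i$ $(i\ne j)$, with basis $e_A=e_{i_1}\cdots e_{i_r}$ for $A=\{i_1<\dots<i_r\}$, norm $|x|=(\sum_A x_A^2)^{1/2}$ and conjugation $\overline{e_A}=\overline{e_{i_r}}\cdots\overline{e_{i_1}}$, $\overline{e_i}=-e_i$. Let $\Omega\subseteq\mathbb{R}^n$ be a minimally smooth domain in the sense of Stein, i.e. $\Omega$ is open and there are $\varepsilon>0$, $N\in\mathbb{N}$, $M\ge 0$ and open sets $U_1,U_2,\dots$ such that every ball $B(x,\varepsilon)$ with $x\in\partial\Omega$ is contained in some $U_k$, no point lies in more than $N$ of the $U_k$, and for every $k$ one has $U_k\cap\Omega=U_k\cap D_k$, where $D_k$ is, up to a rotation, the set of points strictly above the graph of an $M$-Lipschitz function on $\mathbb{R}^{n-1}$. Let $L^2(\Omega)$, $H^1(\Omega)$, $L^2(\partial\Omega)$ be the spaces of $\mathbb{R}_n$-valued functions, with $\langle f,g\rangle=\sum_{A,B}\big(\int f_Ag_B\big)\overline{e_A}e_B$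 and $\|f\|^2=\sum_A\int f_A^2$, let $\|u\|_D=\big(\sum_i\|\partial u/\partial x_i\|_{L^2}^2\big)^{1/2}$, and let $\tau_D:H^1(\Omega)\to L^2(\partial\Omega)$ be the Dirichlet trace operator. Let $a_1,\dots,a_n\in(0,\infty)$ be constants and put $$m_a=\min_i a_i,\qquad M_a=\Big(\sum_{i=1}^n a_i^2\Big)^{1/2}.$$ Let $b\in L^\infty(\partial\Omega)$ be real valued with $b\ge 0$ almost everywhere (the case $b\equiv0$ being the Neumann condition), and let $s=s_0+s_1e_1+\dots+s_ne_n$ with real $s_0,\dots,s_n$ satisfy $$|s|>\frac{M_a}{m_a}|s_0|.$$ For $u,v\in H^1(\Omega)$ put $$q_s(u,v)=\sum_{i=1}^n\Big\langle\frac{\partial u}{\partial x_i},\,a_i^2\frac{\partial v}{\partial x_i}+2s_0a_ie_iv\Big\rangle_{L^2(\Omega)}+|s|^2\langle u,v\rangle_{L^2(\Omega)}+\langle b\,\tau_Du,\tau_Dv\rangle_{L^2(\partial\Omega)}.$$ Then for every $f\in L^2(\Omega)$ there exists a unique $u_f\in H^1(\Omega)$ such that $q_s(u_f,v)=\langle f,v\rangle_{L^2(\Omega)}$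 for all $v\in H^1(\Omega)$. Moreover, $$\|u_f\|_{L^2}\le\frac{\|f\|_{L^2}}{|s|^2-\frac{M_a^2s_0^2}{m_a^2}}\qquad\text{and}\qquad\|u_f\|_D\le\frac{|s|\,\|f\|_{L^2}}{m_a\Big(|s|^2-\frac{M_a^2s_0^2}{m_a^2}\Big)}.$$ -/

import Mathlib

open MeasureTheory Filter Topology
open scoped ContDiff ENNReal NNReal

noncomputable section

namespace SRobin

/-- Euclidean space `ℝⁿ`. -/
abbrev E (n : ℕ) : Type := EuclideanSpace ℝ (Fin n)

/-! ### The Clifford algebra `ℝ_n` -/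

/-- The Clifford algebra `ℝ_n`, in coordinates with respect to the basis vectors
`e_A = e_{i₁} ⋯ e_{i_r}`, `A = {i₁ < ⋯ < i_r} ⊆ {1, …, n}`. Its norm is
`|x| = (∑_A x_A²)^{1/2}`. -/
abbrev Clif (n : ℕ) : Type := EuclideanSpace ℝ (Finset (Fin n))

/-- The basis vector `e_A`. -/
def bv {n : ℕ} (A : Finset (Fin n)) : Clif n := EuclideanSpace.single A (1 : ℝ)

/-- The sign in `e_A e_B = ± e_{A ∆ B}`: sorting the product `e_A e_B` gives a factor `-1` for
every transposition `e_a e_b = - e_b e_a` (`b < a`) and for every square `e_a e_a = -1`. -/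
def csign {n : ℕ} (A B : Finset (Fin n)) : ℝ :=
  ∏ a ∈ A, ∏ b ∈ B, if b ≤ a then (-1 : ℝ) else 1

/-- The product of `ℝ_n`: the bilinear extension of `e_A e_B = csign A B • e_{A ∆ B}`. -/
def cmul {n : ℕ} (x y : Clif n) : Clif n :=
  ∑ A, ∑ B, (csign A B * x A * y B) • bv (symmDiff A B)

/-- The conjugation of `ℝ_n`, `conj e_A = conj e_{i_r} ⋯ conj e_{i₁}` with `conj e_i = - e_i`,
that is `conj e_A = (-1)^{r(r+1)/2} e_A`. -/
def conj {n : ℕ} (x : Clif n) : Clif n :=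
  ∑ A, ((-1 : ℝ) ^ (A.card * (A.card + 1) / 2) * x A) • bv A

/-- The paravectors `x₀ + ∑_i x_i e_i`. -/
def IsParavector {n : ℕ} (x : Clif n) : Prop := ∀ A : Finset (Fin n), 1 < A.card → x A = 0

/-- The scalar part `x₀`. -/
def sc {n : ℕ} (x : Clif n) : ℝ := x ∅

/-! Sanity facts: `ℝ_n` is the associative unital algebra generated by `e₁, …, e_n` with
`e_i² = -1`, `e_i e_j = - e_j e_i`, and `e_A` is the ordered product of its generators. -/

lemma bv_apply {n : ℕ} (A B : Finset (Fin n)) : bv A B = if B = A then (1 : ℝ) else 0 := by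
  simp [bv]

lemma cmul_bv {n : ℕ} (A B : Finset (Fin n)) :
    cmul (bv A) (bv B) = csign A B • bv (symmDiff A B) := by
  unfold cmul
  rw [Finset.sum_eq_single A, Finset.sum_eq_single B]
  · simp [bv_apply]
  · intro C _ hC; simp [bv_apply, hC]
  · simp
  · intro C _ hC; simp [bv_apply, hC]
  · simp

lemma prod_symmDiff_sign {n : ℕ} (f : Fin n → ℝ) (hf : ∀ i, f i * f i = 1)
    (A B : Finset (Fin n)) :
    ∏ i ∈ symmDiff A B, f i = (∏ i ∈ A, f i) * ∏ i ∈ B, f i := by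
  have h1 : ∏ i ∈ symmDiff A B, f i = (∏ i ∈ A \ B, f i) * ∏ i ∈ B \ A, f i := by
    rw [symmDiff_def, Finset.sup_eq_union, Finset.prod_union disjoint_sdiff_sdiff]
  have h2 := Finset.prod_inter_mul_prod_sdiff A B f
  have h3 := Finset.prod_inter_mul_prod_sdiff B A f
  have h4 : (∏ i ∈ A ∩ B, f i) * ∏ i ∈ A ∩ B, f i = 1 := by
    rw [← Finset.prod_mul_distrib]; exact Finset.prod_eq_one fun i _ => hf i
  rw [h1, ← h2, ← h3, Finset.inter_comm B A]
  linear_combination (-(∏ i ∈ A \ B, f i) * ∏ i ∈ B \ A, f i) * h4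

lemma csign_symmDiff_left {n : ℕ} (A B C : Finset (Fin n)) :
    csign (symmDiff A B) C = csign A C * csign B C := by
  unfold csign
  apply prod_symmDiff_sign
  intro i
  rw [← Finset.prod_mul_distrib]
  exact Finset.prod_eq_one fun j _ => by split_ifs <;> norm_num

lemma csign_symmDiff_right {n : ℕ} (A B C : Finset (Fin n)) :
    csign A (symmDiff B C) = csign A B * csign A C := by
  unfold csign
  rw [← Finset.prod_mul_distrib]
  refine Finset.prod_congr rfl fun i _ => ?_
  apply prod_symmDiff_sign
  intro j
  split_ifs <;> norm_num

lemma cmul_add_left {n : ℕ} (x y z : Clif n) : cmul (x + y) z = cmul x z + cmul y z := by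
  simp [cmul, mul_add, add_mul, add_smul, Finset.sum_add_distrib]

lemma cmul_add_right {n : ℕ} (x y z : Clif n) : cmul x (y + z) = cmul x y + cmul x z := by
  simp [cmul, mul_add, add_smul, Finset.sum_add_distrib]

lemma cmul_smul_left {n : ℕ} (r : ℝ) (x y : Clif n) : cmul (r • x) y = r • cmul x y := by
  simp only [cmul, PiLp.smul_apply, smul_eq_mul, Finset.smul_sum, smul_smul]
  refine Finset.sum_congr rfl fun A _ => Finset.sum_congr rfl fun B _ => ?_
  congr 1; ring

lemma cmul_smul_right {n : ℕ} (r : ℝ) (x y : Clif n) : cmul x (r • y) = r • cmul x y := by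
  simp only [cmul, PiLp.smul_apply, smul_eq_mul, Finset.smul_sum, smul_smul]
  refine Finset.sum_congr rfl fun A _ => Finset.sum_congr rfl fun B _ => ?_
  congr 1; ring

/-- The product as a bilinear map. -/
def cmulL (n : ℕ) : Clif n →ₗ[ℝ] Clif n →ₗ[ℝ] Clif n :=
  LinearMap.mk₂ ℝ cmul cmul_add_left cmul_smul_left cmul_add_right cmul_smul_right

lemma sum_bv {n : ℕ} (x : Clif n) : ∑ A, x A • bv A = x := by
  ext B
  simp [bv_apply]

lemma cmul_assoc {n : ℕ} (x y z : Clif n) : cmul (cmul x y) z = cmul x (cmul y z) := by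
  have key : ∀ A B C : Finset (Fin n),
      cmulL n (cmulL n (bv A) (bv B)) (bv C) = cmulL n (bv A) (cmulL n (bv B) (bv C)) := by
    intro A B C
    change cmul (cmul (bv A) (bv B)) (bv C) = cmul (bv A) (cmul (bv B) (bv C))
    rw [cmul_bv, cmul_bv, cmul_smul_left, cmul_smul_right, cmul_bv, cmul_bv, smul_smul, smul_smul,
      symmDiff_assoc, csign_symmDiff_left, csign_symmDiff_right]
    congr 1; ring
  change cmulL n (cmulL n x y) z = cmulL n x (cmulL n y z)
  rw [← sum_bv x, ← sum_bv y, ← sum_bv z]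
  simp only [map_sum, map_smul, LinearMap.sum_apply, LinearMap.smul_apply, key]

lemma one_cmul {n : ℕ} (x : Clif n) : cmul (bv ∅) x = x := by
  change cmulL n (bv ∅) x = x
  conv_lhs => rw [← sum_bv x]
  conv_rhs => rw [← sum_bv x]
  simp only [map_sum, map_smul]
  refine Finset.sum_congr rfl fun A _ => ?_
  change x A • cmul (bv ∅) (bv A) = _
  rw [cmul_bv, ← Finset.bot_eq_empty, bot_symmDiff]; simp [csign]

lemma cmul_one {n : ℕ} (x : Clif n) : cmul x (bv ∅) = x := by
  change cmulL n x (bv ∅) = x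
  conv_lhs => rw [← sum_bv x]
  conv_rhs => rw [← sum_bv x]
  simp only [map_sum, map_smul, LinearMap.sum_apply, LinearMap.smul_apply]
  refine Finset.sum_congr rfl fun A _ => ?_
  change x A • cmul (bv A) (bv ∅) = _
  rw [cmul_bv, ← Finset.bot_eq_empty, symmDiff_bot]; simp [csign]

lemma gen_sq {n : ℕ} (i : Fin n) : cmul (bv {i}) (bv {i}) = -(bv ∅ : Clif n) := by
  rw [cmul_bv]; simp [csign]

lemma gen_anticomm {n : ℕ} {i j : Fin n} (h : i ≠ j) :
    cmul (bv {i}) (bv {j}) = -cmul (bv {j}) (bv {i}) := by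
  rw [cmul_bv, cmul_bv, symmDiff_comm]
  rcases lt_or_gt_of_ne h with h' | h'
  · simp [csign, h'.le, not_le.mpr h']
  · simp [csign, h'.le, not_le.mpr h']

lemma bv_insert {n : ℕ} (i : Fin n) (A : Finset (Fin n)) (h : ∀ a ∈ A, i < a) :
    bv (insert i A) = cmul (bv {i}) (bv A) := by
  have hi : i ∉ A := fun hh => lt_irrefl _ (h i hh)
  have h1 : csign {i} A = 1 := by
    simp only [csign, Finset.prod_singleton]
    exact Finset.prod_eq_one fun a ha => if_neg (not_le.mpr (h a ha))
  have h2 : symmDiff {i} A = insert i A := by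
    rw [(Finset.disjoint_singleton_left.mpr hi).symmDiff_eq_sup]; rfl
  rw [cmul_bv, h1, h2, one_smul]

lemma csign_self {n : ℕ} (A : Finset (Fin n)) :
    csign A A = (-1 : ℝ) ^ (A.card * (A.card + 1) / 2) := by
  induction A using Finset.induction_on_max with
  | empty => simp [csign]
  | insert m A hm ih =>
    have hmA : m ∉ A := fun hh => lt_irrefl _ (hm m hh)
    have hd : symmDiff {m} A = insert m A := by
      rw [(Finset.disjoint_singleton_left.mpr hmA).symmDiff_eq_sup]; rfl
    have h1 : csign {m} {m} = -1 := by simp [csign]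
    have h2 : csign A {m} = 1 := by
      simp only [csign, Finset.prod_singleton]
      exact Finset.prod_eq_one fun a ha => if_neg (not_le.mpr (hm a ha))
    have h3 : csign {m} A = (-1) ^ A.card := by
      simp only [csign, Finset.prod_singleton]
      rw [Finset.prod_congr rfl fun a ha => if_pos (hm a ha).le, Finset.prod_const]
    rw [← hd, csign_symmDiff_left, csign_symmDiff_right, csign_symmDiff_right, h1, h2, h3, ih, hd,
      Finset.card_insert_of_notMem hmA,
      show (A.card + 1) * (A.card + 1 + 1) / 2 = A.card * (A.card + 1) / 2 + (A.card + 1) by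
        rw [show (A.card + 1) * (A.card + 1 + 1) = A.card * (A.card + 1) + (A.card + 1) * 2 by ring,
          Nat.add_mul_div_right _ _ two_pos]]
    ring

lemma conj_bv {n : ℕ} (A : Finset (Fin n)) : conj (bv A) = csign A A • bv A := by
  unfold conj
  rw [Finset.sum_eq_single A]
  · simp [bv_apply, csign_self]
  · intro C _ hC; simp [bv_apply, hC]
  · simp

/-- `conj e_A` is the inverse of `e_A`, as it has to be for the reversed product of the
`conj e_i = - e_i = e_i⁻¹`. -/
lemma cmul_conj_bv {n : ℕ} (A : Finset (Fin n)) : cmul (bv A) (conj (bv A)) = bv ∅ := by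
  have h : csign A A * csign A A = 1 := by
    rw [csign_self, ← mul_pow]; norm_num
  rw [conj_bv, cmul_smul_right, cmul_bv, smul_smul, h, one_smul, symmDiff_self]
  rfl

/-! ### Minimally smooth domains -/

/-- A special Lipschitz domain with bound `M`: up to a rotation, the set of points strictly above
the graph of an `M`-Lipschitz function. Here `ν` is the upward direction and `φ` is a function on
the hyperplane orthogonal to it. -/
def IsSpecialLipschitz {n : ℕ} (M : ℝ≥0) (D : Set (E n)) : Prop :=
  ∃ (ν : E n) (φ : ((ℝ ∙ ν)ᗮ : Submodule ℝ (E n)) → ℝ), ‖ν‖ = 1 ∧ LipschitzWith M φ ∧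
    D = {x | φ ((ℝ ∙ ν)ᗮ.orthogonalProjectionOnto x) < inner ℝ ν x}

/-- Minimally smooth (open) domains in the sense of Stein. -/
def IsMinimallySmooth {n : ℕ} (Ω : Set (E n)) : Prop :=
  IsOpen Ω ∧ ∃ (ε : ℝ) (N : ℕ) (M : ℝ≥0) (U : ℕ → Set (E n)), 0 < ε ∧
    (∀ k, IsOpen (U k)) ∧
    (∀ x ∈ frontier Ω, ∃ k, Metric.ball x ε ⊆ U k) ∧
    (∀ x, {k | x ∈ U k}.encard ≤ N) ∧
    (∀ k, ∃ D : Set (E n), IsSpecialLipschitz M D ∧ U k ∩ Ω = U k ∩ D)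

/-! ### Function spaces -/

/-- The space `L²(Ω)` of square integrable functions `Ω → ℝ_n`. -/
abbrev L2 {n : ℕ} (Ω : Set (E n)) : Type := Lp (Clif n) 2 ((volume : Measure (E n)).restrict Ω)

/-- The surface measure on `∂Ω`: the `(n-1)`-dimensional Hausdorff measure. -/
def surf {n : ℕ} (Ω : Set (E n)) : Measure (E n) :=
  (Measure.euclideanHausdorffMeasure (n - 1)).restrict (frontier Ω)

/-- The space `L²(∂Ω)` of square integrable functions `∂Ω → ℝ_n`. -/
abbrev L2bd {n : ℕ} (Ω : Set (E n)) : Type := Lp (Clif n) 2 (surf Ω)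

/-- The partial derivative `∂φ/∂x_i`. -/
def pd {n : ℕ} {F : Type*} [NormedAddCommGroup F] [NormedSpace ℝ F] (i : Fin n) (φ : E n → F)
    (x : E n) : F :=
  fderiv ℝ φ x (EuclideanSpace.single i (1 : ℝ))

/-- Test functions: real valued, smooth, with compact support in `Ω`. -/
def IsTest {n : ℕ} (Ω : Set (E n)) (φ : E n → ℝ) : Prop :=
  ContDiff ℝ ∞ φ ∧ HasCompactSupport φ ∧ tsupport φ ⊆ Ω

/-- `g` is the weak partial derivative `∂u/∂x_i` in `Ω`. -/
def IsWeakDeriv {n : ℕ} (Ω : Set (E n)) (i : Fin n) (u g : E n → Clif n) : Prop :=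
  ∀ φ : E n → ℝ, IsTest Ω φ →
    ∫ x in Ω, pd i φ x • u x = -∫ x in Ω, φ x • g x

lemma integrable_smul_L2 {n : ℕ} {Ω : Set (E n)} {ψ : E n → ℝ} (hψ : Continuous ψ)
    (hc : HasCompactSupport ψ) (u : L2 Ω) :
    Integrable (fun x => ψ x • u x) (volume.restrict Ω) :=
  memLp_one_iff_integrable.mp
    (MemLp.smul (p := 2) (q := 2) (r := 1) (Lp.memLp u) (hψ.memLp_of_hasCompactSupport hc))

lemma IsTest.continuous_pd {n : ℕ} {Ω : Set (E n)} {φ : E n → ℝ} (h : IsTest Ω φ) (i : Fin n) :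
    Continuous (pd i φ) :=
  (h.1.continuous_fderiv (by simp)).clm_apply continuous_const

lemma IsTest.hasCompactSupport_pd {n : ℕ} {Ω : Set (E n)} {φ : E n → ℝ} (h : IsTest Ω φ)
    (i : Fin n) : HasCompactSupport (pd i φ) :=
  h.2.1.fderiv_apply (𝕜 := ℝ) _

/-- The Sobolev space `H¹(Ω)`, realised as the space of all pairs `(u, ∇u)` with `u ∈ L²(Ω)` and
weak gradient `∇u = (∂u/∂x₁, …, ∂u/∂x_n) ∈ L²(Ω)ⁿ`. The weak gradient is determined by `u`, and
the norm is `(‖u‖² + ∑_i ‖∂u/∂x_i‖²)^{1/2}`. -/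
def H1 {n : ℕ} (Ω : Set (E n)) :
    Submodule ℝ (WithLp 2 (L2 Ω × PiLp 2 (fun _ : Fin n => L2 Ω))) where
  carrier := {w | ∀ i, IsWeakDeriv Ω i w.fst (w.snd i)}
  zero_mem' := by
    intro i φ hφ
    have h1 : ∀ ψ : E n → ℝ, ∫ x in Ω, ψ x • (⇑(0 : L2 Ω) : E n → Clif n) x = 0 := by
      intro ψ
      refine integral_eq_zero_of_ae ?_
      filter_upwards [Lp.coeFn_zero (Clif n) 2 (volume.restrict Ω)] with x hx
      rw [hx]; simp
    exact (h1 (pd i φ)).trans (by rw [← neg_zero, ← h1 φ]; rfl)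
  add_mem' := by
    intro v w hv hw i φ hφ
    have h1 : ∀ (ψ : E n → ℝ) (f g : L2 Ω), Continuous ψ → HasCompactSupport ψ →
        ∫ x in Ω, ψ x • (⇑(f + g : L2 Ω) : E n → Clif n) x
          = (∫ x in Ω, ψ x • f x) + ∫ x in Ω, ψ x • g x := by
      intro ψ f g hc hs
      rw [← integral_add (integrable_smul_L2 hc hs f) (integrable_smul_L2 hc hs g)]
      refine integral_congr_ae ?_
      filter_upwards [Lp.coeFn_add f g] with x hx
      rw [hx, Pi.add_apply, smul_add]
    have e1 := h1 (pd i φ) v.fst w.fst (hφ.continuous_pd i) (hφ.hasCompactSupport_pd i)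
    have e2 := h1 φ (v.snd i) (w.snd i) hφ.1.continuous hφ.2.1
    refine e1.trans ?_
    rw [hv i φ hφ, hw i φ hφ, ← neg_add, ← e2]
    rfl
  smul_mem' := by
    intro c w hw i φ hφ
    have h1 : ∀ (ψ : E n → ℝ) (f : L2 Ω),
        ∫ x in Ω, ψ x • (⇑(c • f : L2 Ω) : E n → Clif n) x = c • ∫ x in Ω, ψ x • f x := by
      intro ψ f
      rw [← integral_smul]
      refine integral_congr_ae ?_
      filter_upwards [Lp.coeFn_smul c f] with x hx
      simp only [hx, Pi.smul_apply]
      rw [smul_comm]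
    refine (h1 (pd i φ) w.fst).trans ?_
    rw [hw i φ hφ, smul_neg, ← h1 φ (w.snd i)]
    rfl

/-- The function underlying an element of `H¹(Ω)`. -/
def fn {n : ℕ} {Ω : Set (E n)} (u : H1 Ω) : L2 Ω := u.1.fst

/-- The weak derivative `∂u/∂x_i ∈ L²(Ω)` of an element of `H¹(Ω)`. -/
def der {n : ℕ} {Ω : Set (E n)} (u : H1 Ω) (i : Fin n) : L2 Ω := u.1.snd i

/-- The Sobolev seminorm `‖u‖_D = (∑_i ‖∂u/∂x_i‖²)^{1/2}`. -/
def seminormD {n : ℕ} {Ω : Set (E n)} (u : H1 Ω) : ℝ := Real.sqrt (∑ i, ‖der u i‖ ^ 2)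

/-! ### The Dirichlet trace -/

/-- `g ∈ L²(∂Ω)` is the trace of `u ∈ H¹(Ω)`: there are smooth, compactly supported functions
on `ℝⁿ` which converge to `u` in `H¹(Ω)` and whose restrictions to `∂Ω` converge to `g` in
`L²(∂Ω)`. -/
def IsTrace {n : ℕ} {Ω : Set (E n)} (u : H1 Ω) (g : L2bd Ω) : Prop :=
  ∃ φ : ℕ → E n → Clif n,
    (∀ k, ContDiff ℝ ∞ (φ k) ∧ HasCompactSupport (φ k)) ∧
    Tendsto (fun k => eLpNorm (fun x => φ k x - fn u x) 2 (volume.restrict Ω)) atTop (𝓝 0) ∧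
    (∀ i, Tendsto (fun k => eLpNorm (fun x => pd i (φ k) x - der u i x) 2 (volume.restrict Ω))
      atTop (𝓝 0)) ∧
    Tendsto (fun k => eLpNorm (fun x => φ k x - g x) 2 (surf Ω)) atTop (𝓝 0)

open Classical in
/-- The Dirichlet trace operator `τ_D : H¹(Ω) → L²(∂Ω)`, the continuous extension of
`φ ↦ φ|_{∂Ω}`. -/
def trace {n : ℕ} {Ω : Set (E n)} (u : H1 Ω) : L2bd Ω :=
  if h : ∃ g, IsTrace u g then h.choose else 0

/-! ### The Robin form -/

/-- The `ℝ_n`-valued inner product `⟨f, g⟩ = ∑_{A,B} ⟨f_A, g_B⟩ conj(e_A) e_B` of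
square integrable functions. -/
def cinner {n : ℕ} (μ : Measure (E n)) (f g : E n → Clif n) : Clif n :=
  ∑ A, ∑ B, (∫ x, f x A * g x B ∂μ) • cmul (conj (bv A)) (bv B)

/-- The function `B_i = ∑_j e_j a_j ∂a_i/∂x_j`. -/
def Bcoef {n : ℕ} (a : Fin n → E n → ℝ) (i : Fin n) (x : E n) : Clif n :=
  ∑ j, (a j x * pd j (a i) x) • bv {j}

/-- The Robin form
`q_s(u,v) = ∑_i ⟨∂_i u, a_i² ∂_i v + (2 s₀ a_i - B_i) e_i v⟩ + |s|² ⟨u, v⟩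
  + ⟨b τ_D u, τ_D v⟩_{L²(∂Ω)}` of the operator `T = ∑_i e_i a_i ∂/∂x_i`. -/
def robinForm {n : ℕ} {Ω : Set (E n)} (a : Fin n → E n → ℝ) (b : E n → ℝ) (s : Clif n)
    (u v : H1 Ω) : Clif n :=
  (∑ i, cinner (volume.restrict Ω) (der u i) (fun x =>
      a i x ^ 2 • der v i x
        + cmul ((2 * sc s * a i x) • bv ∅ - Bcoef a i x) (cmul (bv {i}) (fn v x))))
    + ‖s‖ ^ 2 • cinner (volume.restrict Ω) (fn u) (fn v)
    + cinner (surf Ω) (fun x => b x • trace u x) (trace v)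

/-- `u ∈ H¹(Ω)` is a weak solution of the Robin problem: `q_s(u,v) = ⟨f,v⟩` for all
`v ∈ H¹(Ω)`. -/
def IsRobinSolution {n : ℕ} {Ω : Set (E n)} (a : Fin n → E n → ℝ) (b : E n → ℝ) (s : Clif n)
    (f : L2 Ω) (u : H1 Ω) : Prop :=
  ∀ v : H1 Ω, robinForm a b s u v = cinner (volume.restrict Ω) f (fn v)

/-- `m_a = min_i a_i` for constant coefficients. -/
def lowerBound {n : ℕ} (a : Fin n → ℝ) : ℝ := ⨅ i, a i

/-- `M_a = (∑_i a_i²)^{1/2}` for constant coefficients. -/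
def upperBound {n : ℕ} (a : Fin n → ℝ) : ℝ := Real.sqrt (∑ i, a i ^ 2)

end SRobin

end

open MeasureTheory Filter Topology
open scoped ContDiff ENNReal NNReal

noncomputable section

namespace SRobin

/-! ### The Sobolev space `H¹(Ω)` -/

section Sobolev

variable {n : ℕ} {Ω : Set (E n)}

lemma IsWeakDeriv.congr {i : Fin n} {u u' g g' : E n → Clif n} (h : IsWeakDeriv Ω i u g)
    (hu : u =ᵐ[volume.restrict Ω] u') (hg : g =ᵐ[volume.restrict Ω] g') :
    IsWeakDeriv Ω i u' g' := by
  intro φ hφ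
  have e1 : ∫ x in Ω, pd i φ x • u' x = ∫ x in Ω, pd i φ x • u x :=
    integral_congr_ae (by filter_upwards [hu] with x hx; rw [hx])
  have e2 : ∫ x in Ω, φ x • g' x = ∫ x in Ω, φ x • g x :=
    integral_congr_ae (by filter_upwards [hg] with x hx; rw [hx])
  rw [e1, e2, h φ hφ]

/-- The element of `H¹(Ω)` given by a function and its weak derivatives. -/
def H1mk (u : E n → Clif n) (g : Fin n → E n → Clif n) (hu : MemLp u 2 (volume.restrict Ω))
    (hg : ∀ i, MemLp (g i) 2 (volume.restrict Ω)) (h : ∀ i, IsWeakDeriv Ω i u (g i)) : H1 Ω :=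
  ⟨WithLp.toLp 2 (hu.toLp u, WithLp.toLp 2 fun i => (hg i).toLp (g i)),
    fun i => (h i).congr hu.coeFn_toLp.symm (hg i).coeFn_toLp.symm⟩

section
variable {u : E n → Clif n} {g : Fin n → E n → Clif n} (hu : MemLp u 2 (volume.restrict Ω))
    (hg : ∀ i, MemLp (g i) 2 (volume.restrict Ω)) (h : ∀ i, IsWeakDeriv Ω i u (g i))

lemma der_H1mk (i : Fin n) : der (H1mk u g hu hg h) i = (hg i).toLp (g i) := rfl

end

lemma isWeakDeriv_der (u : H1 Ω) (i : Fin n) : IsWeakDeriv Ω i (fn u) (der u i) := u.2 i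

lemma H1.ext {u v : H1 Ω} (h : fn u = fn v) (h' : ∀ i, der u i = der v i) : u = v := by
  apply Subtype.ext
  apply (WithLp.equiv 2 _).injective
  refine Prod.ext h ?_
  apply (WithLp.equiv 2 _).injective
  exact funext h'

/-- `fn` as a continuous linear map. -/
def fnL (Ω : Set (E n)) : H1 Ω →L[ℝ] L2 Ω := (WithLp.fstL 2 ℝ _ _).comp (H1 Ω).subtypeL

/-- `der` as a continuous linear map. -/
def derL (Ω : Set (E n)) (i : Fin n) : H1 Ω →L[ℝ] L2 Ω :=
  ((PiLp.proj 2 (𝕜 := ℝ) (fun _ : Fin n => L2 Ω) i).comp (WithLp.sndL 2 ℝ _ _)).comp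
    (H1 Ω).subtypeL

@[simp] lemma fnL_apply (u : H1 Ω) : fnL Ω u = fn u := rfl

@[simp] lemma derL_apply (u : H1 Ω) (i : Fin n) : derL Ω i u = der u i := rfl

lemma fn_add (u v : H1 Ω) : fn (u + v) = fn u + fn v := rfl
lemma fn_sub (u v : H1 Ω) : fn (u - v) = fn u - fn v := rfl
lemma der_add (u v : H1 Ω) (i : Fin n) : der (u + v) i = der u i + der v i := rfl
lemma der_sub (u v : H1 Ω) (i : Fin n) : der (u - v) i = der u i - der v i := rfl
lemma der_smul (c : ℝ) (u : H1 Ω) (i : Fin n) : der (c • u) i = c • der u i := rfl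

lemma norm_sq_H1 (u : H1 Ω) : ‖u‖ ^ 2 = ‖fn u‖ ^ 2 + ∑ i, ‖der u i‖ ^ 2 := by
  have := WithLp.prod_norm_sq_eq_of_L2 u.1
  rw [PiLp.norm_sq_eq_of_L2] at this
  exact this

lemma tendsto_H1_iff {ι : Type*} {l : Filter ι} {u : ι → H1 Ω} {v : H1 Ω} :
    Tendsto u l (𝓝 v) ↔ Tendsto (fun k => fn (u k)) l (𝓝 (fn v)) ∧
      ∀ i, Tendsto (fun k => der (u k) i) l (𝓝 (der v i)) := by
  constructor
  · intro h
    exact ⟨((fnL Ω).continuous.tendsto v).comp h, fun i => ((derL Ω i).continuous.tendsto v).comp h⟩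
  · rintro ⟨h1, h2⟩
    rw [tendsto_iff_norm_sub_tendsto_zero] at h1 ⊢
    have h3 : Tendsto (fun k => ‖u k - v‖ ^ 2) l (𝓝 0) := by
      have : Tendsto (fun k => ‖fn (u k) - fn v‖ ^ 2 + ∑ i, ‖der (u k) i - der v i‖ ^ 2) l
          (𝓝 (0 ^ 2 + ∑ _i : Fin n, (0 : ℝ) ^ 2)) :=
        (h1.pow 2).add (tendsto_finsetSum _ fun i _ =>
          (tendsto_iff_norm_sub_tendsto_zero.mp (h2 i)).pow 2)
      simp only [norm_sq_H1, fn_sub, der_sub]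
      simpa using this
    simpa using h3.sqrt

lemma integrable_pd_smul {φ : E n → ℝ} (hφ : IsTest Ω φ) (i : Fin n) (u : L2 Ω) :
    Integrable (fun x => pd i φ x • u x) (volume.restrict Ω) :=
  integrable_smul_L2 (hφ.continuous_pd i) (hφ.hasCompactSupport_pd i) u

lemma continuous_integral_smul_L2 {ψ : E n → ℝ} (hψ : Continuous ψ) (hc : HasCompactSupport ψ) :
    Continuous fun u : L2 Ω => ∫ x in Ω, ψ x • u x := by
  have hm : MemLp ψ 2 (volume.restrict Ω) := hψ.memLp_of_hasCompactSupport hc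
  have := ((ContinuousLinearMap.lsmul ℝ ℝ (E := Clif n)).lpPairing
    (volume.restrict Ω) 2 2 (hm.toLp ψ)).continuous
  convert! this using 2 with u
  rw [ContinuousLinearMap.lpPairing_eq_integral]
  refine integral_congr_ae ?_
  filter_upwards [hm.coeFn_toLp] with x hx
  rw [hx]; rfl

lemma isClosed_H1 : IsClosed (H1 Ω : Set (WithLp 2 (L2 Ω × PiLp 2 (fun _ : Fin n => L2 Ω)))) := by
  have : (H1 Ω : Set (WithLp 2 (L2 Ω × PiLp 2 (fun _ : Fin n => L2 Ω)))) =
      ⋂ (i : Fin n) (φ : E n → ℝ) (_ : IsTest Ω φ), {w | ∫ x in Ω, pd i φ x • w.fst x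
        = -∫ x in Ω, φ x • w.snd i x} := by
    ext w; simp only [Set.mem_iInter]; rfl
  rw [this]
  refine isClosed_iInter fun i => isClosed_iInter fun φ => isClosed_iInter fun hφ => ?_
  refine isClosed_eq ?_ ?_
  · exact (continuous_integral_smul_L2 (hφ.continuous_pd i) (hφ.hasCompactSupport_pd i)).comp
      (WithLp.fstL 2 ℝ _ _).continuous
  · exact ((continuous_integral_smul_L2 hφ.1.continuous hφ.2.1).comp
      ((PiLp.proj 2 (𝕜 := ℝ) (fun _ : Fin n => L2 Ω) i).comp (WithLp.sndL 2 ℝ _ _)).continuous).neg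

instance : CompleteSpace (H1 Ω) := isClosed_H1.completeSpace_coe

/-! ### Products with smooth functions -/

section pd

variable {F : Type*} [NormedAddCommGroup F] [NormedSpace ℝ F]

lemma continuous_pd_of_contDiff {φ : E n → F} (h : ContDiff ℝ ∞ φ) (i : Fin n) :
    Continuous (pd i φ) :=
  (h.continuous_fderiv (by simp)).clm_apply continuous_const

lemma hasCompactSupport_pd_of {φ : E n → F} (h : HasCompactSupport φ) (i : Fin n) :
    HasCompactSupport (pd i φ) :=
  h.fderiv_apply (𝕜 := ℝ) _

lemma pd_smul {ψ : E n → ℝ} {φ : E n → F} (hψ : ContDiff ℝ ∞ ψ) (hφ : ContDiff ℝ ∞ φ) (i : Fin n)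
    (x : E n) : pd i (fun y => ψ y • φ y) x = ψ x • pd i φ x + pd i ψ x • φ x := by
  unfold pd
  rw [fderiv_fun_smul (hψ.differentiable (by simp) x) (hφ.differentiable (by simp) x)]
  simp

lemma pd_mul {ψ φ : E n → ℝ} (hψ : ContDiff ℝ ∞ ψ) (hφ : ContDiff ℝ ∞ φ) (i : Fin n)
    (x : E n) : pd i (fun y => ψ y * φ y) x = ψ x * pd i φ x + pd i ψ x * φ x := pd_smul hψ hφ i x

lemma pd_add {ψ φ : E n → F} (hψ : ContDiff ℝ ∞ ψ) (hφ : ContDiff ℝ ∞ φ) (i : Fin n)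
    (x : E n) : pd i (ψ + φ) x = pd i ψ x + pd i φ x := by
  unfold pd
  rw [fderiv_add (hψ.differentiable (by simp) x) (hφ.differentiable (by simp) x)]
  simp

lemma pd_const_smul {φ : E n → F} (hφ : ContDiff ℝ ∞ φ) (i : Fin n) (c : ℝ)
    (x : E n) : pd i (c • φ) x = c • pd i φ x := by
  unfold pd
  rw [fderiv_const_smul (hφ.differentiable (by simp) x)]
  simp

lemma pd_eq_zero_of_notMem_tsupport {φ : E n → F} {x : E n} (hx : x ∉ tsupport φ) (i : Fin n) :
    pd i φ x = 0 := by
  unfold pd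
  rw [fderiv_of_notMem_tsupport ℝ hx]; rfl

end pd

lemma memLp_smul_L2 {ψ : E n → ℝ} (hψ : Continuous ψ) (hc : HasCompactSupport ψ) (u : L2 Ω) :
    MemLp (fun x => ψ x • u x) 2 (volume.restrict Ω) :=
  MemLp.smul (p := ∞) (q := 2) (r := 2) (Lp.memLp u) (hψ.memLp_of_hasCompactSupport hc)

lemma IsWeakDeriv.smul {ψ : E n → ℝ} (hψ : ContDiff ℝ ∞ ψ) {u g : L2 Ω}
    {i : Fin n} (h : IsWeakDeriv Ω i u g) :
    IsWeakDeriv Ω i (fun x => ψ x • u x) (fun x => ψ x • g x + pd i ψ x • u x) := by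
  intro φ hφ
  have hφψ : IsTest Ω (fun x => φ x * ψ x) :=
    ⟨hφ.1.mul hψ, hφ.2.1.mul_right,
      (closure_mono (Function.support_mul_subset_left _ _)).trans hφ.2.2⟩
  have e := h _ hφψ
  have i1 : Integrable (fun x => (φ x * pd i ψ x) • u x) (volume.restrict Ω) :=
    integrable_smul_L2 (hφ.1.continuous.mul (continuous_pd_of_contDiff hψ i))
      hφ.2.1.mul_right u
  have i2 : Integrable (fun x => (φ x * ψ x) • g x) (volume.restrict Ω) :=
    integrable_smul_L2 (hφ.1.continuous.mul hψ.continuous) hφ.2.1.mul_right g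
  have i3 := integrable_pd_smul hφψ i u
  have e1 : ∫ x in Ω, pd i φ x • ψ x • u x = (∫ x in Ω, pd i (fun x => φ x * ψ x) x • u x)
      - ∫ x in Ω, (φ x * pd i ψ x) • u x := by
    rw [← integral_sub i3 i1]
    congr 1; ext1 x
    rw [pd_mul hφ.1 hψ, ← sub_smul, smul_smul]; congr 1; ring
  have e2 : ∫ x in Ω, φ x • (ψ x • g x + pd i ψ x • u x) = (∫ x in Ω, (φ x * ψ x) • g x)
      + ∫ x in Ω, (φ x * pd i ψ x) • u x := by
    rw [← integral_add i2 i1]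
    congr 1; ext1 x
    rw [smul_add, smul_smul, smul_smul]
  rw [e1, e2, e]; abel

/-- The product of an element of `H¹(Ω)` with a smooth compactly supported function. -/
def mulH1 {ψ : E n → ℝ} (hψ : ContDiff ℝ ∞ ψ) (hc : HasCompactSupport ψ) (u : H1 Ω) : H1 Ω :=
  H1mk (fun x => ψ x • fn u x) (fun i x => ψ x • der u i x + pd i ψ x • fn u x)
    (memLp_smul_L2 hψ.continuous hc _)
    (fun i => (memLp_smul_L2 hψ.continuous hc _).add (memLp_smul_L2
      (continuous_pd_of_contDiff hψ i) (hasCompactSupport_pd_of hc i) _))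
    (fun i => (isWeakDeriv_der u i).smul hψ)

section
variable {ψ : E n → ℝ} (hψ : ContDiff ℝ ∞ ψ) (hc : HasCompactSupport ψ)

lemma fn_mulH1 (u : H1 Ω) :
    fn (mulH1 hψ hc u) =ᵐ[volume.restrict Ω] fun x => ψ x • fn u x :=
  (memLp_smul_L2 hψ.continuous hc _).coeFn_toLp

lemma der_mulH1 (u : H1 Ω) (i : Fin n) : der (mulH1 hψ hc u) i =ᵐ[volume.restrict Ω]
    fun x => ψ x • der u i x + pd i ψ x • fn u x :=
  ((memLp_smul_L2 hψ.continuous hc _).add (memLp_smul_L2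
    (continuous_pd_of_contDiff hψ i) (hasCompactSupport_pd_of hc i) _)).coeFn_toLp

end

lemma mulH1_mulH1 {ψ χ : E n → ℝ} (hψ : ContDiff ℝ ∞ ψ) (hc : HasCompactSupport ψ)
    (hχ : ContDiff ℝ ∞ χ) (hc' : HasCompactSupport χ) (u : H1 Ω) :
    mulH1 hψ hc (mulH1 hχ hc' u)
      = mulH1 (ψ := fun x => ψ x * χ x) (hψ.mul hχ) hc.mul_right u := by
  refine H1.ext (Lp.ext ?_) fun i => Lp.ext ?_
  · filter_upwards [fn_mulH1 hψ hc (mulH1 hχ hc' u), fn_mulH1 hχ hc' u,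
      fn_mulH1 (ψ := fun x => ψ x * χ x) (hψ.mul hχ) hc.mul_right u] with x h1 h2 h3
    rw [h1, h2, h3, smul_smul]
  · filter_upwards [der_mulH1 hψ hc (mulH1 hχ hc' u) i, der_mulH1 hχ hc' u i, fn_mulH1 hχ hc' u,
      der_mulH1 (ψ := fun x => ψ x * χ x) (hψ.mul hχ) hc.mul_right u i] with x h1 h2 h4 h3
    rw [h1, h2, h3, h4, pd_mul hψ hχ]
    module

/-! ### Smooth functions in `H¹(Ω)` -/

/-- The smooth, compactly supported functions `ℝⁿ → ℝ_n`. -/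
def Smooth (n : ℕ) : Submodule ℝ (E n → Clif n) where
  carrier := {φ | ContDiff ℝ ∞ φ ∧ HasCompactSupport φ}
  zero_mem' := ⟨contDiff_const, HasCompactSupport.zero⟩
  add_mem' h h' := ⟨h.1.add h'.1, h.2.add h'.2⟩
  smul_mem' c _ h := ⟨h.1.const_smul c, h.2.smul_left (f := fun _ => c)⟩

lemma Smooth.memLp (φ : Smooth n) (μ : Measure (E n)) [IsFiniteMeasureOnCompacts μ] :
    MemLp φ.1 2 μ := φ.2.1.continuous.memLp_of_hasCompactSupport φ.2.2

lemma Smooth.memLp_pd (φ : Smooth n) (i : Fin n) (μ : Measure (E n))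
    [IsFiniteMeasureOnCompacts μ] : MemLp (pd i φ.1) 2 μ :=
  (continuous_pd_of_contDiff φ.2.1 i).memLp_of_hasCompactSupport (hasCompactSupport_pd_of φ.2.2 i)

lemma Smooth.isWeakDeriv (φ : Smooth n) (i : Fin n) : IsWeakDeriv Ω i φ.1 (pd i φ.1) := by
  intro η hη
  have h0 : ∀ x ∉ Ω, x ∉ tsupport η := fun x hx h => hx (hη.2.2 h)
  rw [setIntegral_eq_integral_of_forall_compl_eq_zero, setIntegral_eq_integral_of_forall_compl_eq_zero]
  · have hp := continuous_pd_of_contDiff φ.2.1 i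
    have := integral_smul_fderiv_eq_neg_fderiv_smul_of_integrable (μ := (volume : Measure (E n)))
      (f := η) (g := φ.1) (v := EuclideanSpace.single i (1 : ℝ)) (𝕜 := ℝ)
      (((hη.continuous_pd i).smul φ.2.1.continuous).integrable_of_hasCompactSupport
        (hη.hasCompactSupport_pd i).smul_right)
      ((hη.1.continuous.smul hp).integrable_of_hasCompactSupport hη.2.1.smul_right)
      ((hη.1.continuous.smul φ.2.1.continuous).integrable_of_hasCompactSupport hη.2.1.smul_right)
      (fun x _ => hη.1.differentiable (by simp) x) (fun x _ => φ.2.1.differentiable (by simp) x)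
    change ∫ x, η x • pd i φ.1 x = -∫ x, pd i η x • φ.1 x at this
    rw [this, neg_neg]
  · intro x hx; rw [image_eq_zero_of_notMem_tsupport (h0 x hx), zero_smul]
  · intro x hx; rw [pd_eq_zero_of_notMem_tsupport (h0 x hx), zero_smul]

/-- The restriction to `Ω` of smooth functions, as a map to `H¹(Ω)`. -/
def ofSmooth (Ω : Set (E n)) : Smooth n →ₗ[ℝ] H1 Ω where
  toFun φ := H1mk φ.1 (fun i => pd i φ.1) (Smooth.memLp φ _) (fun i => Smooth.memLp_pd φ i _) (Smooth.isWeakDeriv φ)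
  map_add' φ ψ := by
    refine H1.ext rfl fun i => ?_
    rw [der_add, der_H1mk, der_H1mk, der_H1mk, ← MemLp.toLp_add]
    exact MemLp.toLp_congr _ _ (.of_forall fun x => pd_add φ.2.1 ψ.2.1 i x)
  map_smul' c φ := by
    refine H1.ext rfl fun i => ?_
    rw [RingHom.id_apply, der_smul, der_H1mk, der_H1mk, ← MemLp.toLp_const_smul]
    exact MemLp.toLp_congr _ _ (.of_forall fun x => pd_const_smul φ.2.1 i c x)

lemma fn_ofSmooth (φ : Smooth n) : fn (ofSmooth Ω φ) = (Smooth.memLp φ _).toLp φ.1 := rfl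

lemma der_ofSmooth (φ : Smooth n) (i : Fin n) :
    der (ofSmooth Ω φ) i = (Smooth.memLp_pd φ i _).toLp (pd i φ.1) := rfl

lemma tendsto_ofSmooth_iff {ι : Type*} {l : Filter ι} {φ : ι → Smooth n} {u : H1 Ω} :
    Tendsto (fun k => ofSmooth Ω (φ k)) l (𝓝 u) ↔
      Tendsto (fun k => eLpNorm (fun x => (φ k).1 x - fn u x) 2 (volume.restrict Ω)) l (𝓝 0) ∧
      ∀ i, Tendsto (fun k => eLpNorm (fun x => pd i (φ k).1 x - der u i x) 2 (volume.restrict Ω))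
        l (𝓝 0) := by
  rw [tendsto_H1_iff]
  refine and_congr ?_ (forall_congr' fun i => ?_)
  · rw [Lp.tendsto_Lp_iff_tendsto_eLpNorm']
    refine tendsto_congr fun k => eLpNorm_congr_ae ?_
    filter_upwards [(Smooth.memLp (φ k) (volume.restrict Ω)).coeFn_toLp] with x hx
    rw [Pi.sub_apply, fn_ofSmooth, hx]
  · rw [Lp.tendsto_Lp_iff_tendsto_eLpNorm']
    refine tendsto_congr fun k => eLpNorm_congr_ae ?_
    filter_upwards [(Smooth.memLp_pd (φ k) i (volume.restrict Ω)).coeFn_toLp] with x hx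
    rw [Pi.sub_apply, der_ofSmooth, hx]

end Sobolev

/-! ### The trace inequality -/

section TraceInequality

lemma ennreal_add_sq_le (a b : ℝ≥0∞) : (a + b) ^ 2 ≤ 2 * (a ^ 2 + b ^ 2) := by
  have h := ENNReal.rpow_add_le_mul_rpow_add_rpow a b (p := 2) (by norm_num)
  norm_num at h
  exact h

/-- Cauchy–Schwarz inequality for a lower integral of a nonnegative function. -/
lemma sq_lintegral_le {α : Type*} [MeasurableSpace α] {μ : Measure α} {g : α → ℝ≥0∞}
    (hg : AEMeasurable g μ) : (∫⁻ x, g x ∂μ) ^ 2 ≤ μ Set.univ * ∫⁻ x, g x ^ 2 ∂μ := by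
  have h := ENNReal.lintegral_mul_le_Lp_mul_Lq μ (p := 2) (q := 2)
    (Real.holderConjugate_iff.mpr ⟨by norm_num, by norm_num⟩) (f := fun _ => 1) aemeasurable_const hg
  have h2 : ∀ a : ℝ≥0∞, (a ^ (1 / 2 : ℝ)) ^ 2 = a := fun a => by
    rw [← ENNReal.rpow_natCast, ← ENNReal.rpow_mul]; norm_num
  calc (∫⁻ x, g x ∂μ) ^ 2 ≤ ((∫⁻ _x, 1 ^ (2 : ℝ) ∂μ) ^ (1 / 2 : ℝ)
        * (∫⁻ x, g x ^ (2 : ℝ) ∂μ) ^ (1 / 2 : ℝ)) ^ 2 := by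
        gcongr; simpa using h
    _ = _ := by
        rw [mul_pow, h2, h2]
        simp only [ENNReal.rpow_two, one_pow, lintegral_one]

/-- One-dimensional trace inequality on an interval of length `ε`. -/
lemma enorm_sq_le_lintegral_Ioo {F : Type*} [NormedAddCommGroup F] [NormedSpace ℝ F]
    [CompleteSpace F] {f : ℝ → F} (hf : ContDiff ℝ 1 f) (ε : ℝ) :
    ENNReal.ofReal ε * ‖f 0‖ₑ ^ 2 ≤ 2 * ((∫⁻ t in Set.Ioo 0 ε, ‖f t‖ₑ ^ 2)
      + ENNReal.ofReal ε ^ 2 * ∫⁻ t in Set.Ioo 0 ε, ‖deriv f t‖ₑ ^ 2) := by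
  have hd : Continuous (deriv f) := hf.continuous_deriv le_rfl
  set K := ∫⁻ t in Set.Ioo 0 ε, ‖deriv f t‖ₑ with hK
  have hvol : (volume.restrict (Set.Ioo 0 ε)) Set.univ = ENNReal.ofReal ε := by simp
  have hKsq : K ^ 2 ≤ ENNReal.ofReal ε * ∫⁻ t in Set.Ioo 0 ε, ‖deriv f t‖ₑ ^ 2 := by
    rw [← hvol]; exact sq_lintegral_le hd.enorm.measurable.aemeasurable
  have key : ∀ t ∈ Set.Ioo 0 ε, ‖f 0‖ₑ ≤ ‖f t‖ₑ + K := by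
    intro t ht
    have e : ∫ s in (0 : ℝ)..t, deriv f s = f t - f 0 :=
      intervalIntegral.integral_deriv_eq_sub (fun x _ => hf.differentiable (by simp) x)
        (hd.intervalIntegrable _ _)
    have e' : f 0 = f t - ∫ s in Set.Ioc 0 t, deriv f s := by
      rw [← intervalIntegral.integral_of_le ht.1.le, e]; abel
    rw [e']
    refine (enorm_sub_le).trans ?_
    gcongr
    refine (enorm_integral_le_lintegral_enorm _).trans ?_
    exact lintegral_mono_set fun s hs => ⟨hs.1, hs.2.trans_lt ht.2⟩
  calc ENNReal.ofReal ε * ‖f 0‖ₑ ^ 2 = ∫⁻ _t in Set.Ioo 0 ε, ‖f 0‖ₑ ^ 2 := by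
        rw [lintegral_const, hvol, mul_comm]
    _ ≤ ∫⁻ t in Set.Ioo 0 ε, 2 * (‖f t‖ₑ ^ 2 + K ^ 2) := by
        refine setLIntegral_mono' measurableSet_Ioo fun t ht => ?_
        refine le_trans ?_ (ennreal_add_sq_le _ _)
        gcongr
        exact key t ht
    _ = 2 * ((∫⁻ t in Set.Ioo 0 ε, ‖f t‖ₑ ^ 2) + ENNReal.ofReal ε * K ^ 2) := by
        rw [lintegral_const_mul' _ _ (by simp), lintegral_add_right _ measurable_const,
          lintegral_const, hvol, mul_comm (K ^ 2)]
    _ ≤ _ := by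
        rw [pow_two (ENNReal.ofReal ε), mul_assoc]
        gcongr

variable {n : ℕ}

/-- Integration over the lines orthogonal to a hyperplane, started on a graph. -/
lemma lintegral_lintegral_graph {ν : E n} (hν : ‖ν‖ = 1) {G : E n → ℝ≥0∞} (hG : Measurable G)
    (φ : ((ℝ ∙ ν)ᗮ : Submodule ℝ (E n)) → ℝ) :
    ∫⁻ y : ((ℝ ∙ ν)ᗮ : Submodule ℝ (E n)), ∫⁻ t : ℝ, G ((y : E n) + φ y • ν + t • ν) =
      ∫⁻ x, G x := by
  have h1 : ∀ y : ((ℝ ∙ ν)ᗮ : Submodule ℝ (E n)),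
      ∫⁻ t : ℝ, G ((y : E n) + φ y • ν + t • ν) = ∫⁻ z : (ℝ ∙ ν), G ((z : E n) + y) := by
    intro y
    have e := lintegral_add_left_eq_self (μ := (volume : Measure ℝ))
      (fun t => G ((y : E n) + t • ν)) (φ y)
    simp only [add_smul, ← add_assoc] at e
    rw [e]
    have mp := (LinearIsometryEquiv.toSpanUnitSingleton (𝕜 := ℝ) ν hν).measurePreserving
    rw [← mp.lintegral_comp (f := fun z : (ℝ ∙ ν) => G ((z : E n) + y)) (by fun_prop)]
    refine lintegral_congr fun t => ?_
    rw [add_comm]; rfl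
  simp_rw [h1]
  have mp2 := (Submodule.measurePreserving_measurableEquivProd (ℝ ∙ ν) (0 : E n)).symm
  rw [InnerProductSpace.euclideanHausdorffMeasure_eq_volume] at mp2
  rw [← mp2.lintegral_comp hG, Measure.volume_eq_prod, lintegral_prod_symm]
  · simp
  · simp only [Submodule.measurableEquivProd_symm_apply, vadd_eq_add, add_zero]
    exact Measurable.aemeasurable (by fun_prop)

/-- The graph map over the hyperplane orthogonal to `ν`. -/
def graphMap (ν : E n) (φ : ((ℝ ∙ ν)ᗮ : Submodule ℝ (E n)) → ℝ)
    (y : ((ℝ ∙ ν)ᗮ : Submodule ℝ (E n))) : E n := (y : E n) + φ y • ν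

lemma lipschitzWith_graphMap {ν : E n} (hν : ‖ν‖ = 1) {M : ℝ≥0}
    {φ : ((ℝ ∙ ν)ᗮ : Submodule ℝ (E n)) → ℝ} (hφ : LipschitzWith M φ) :
    LipschitzWith (1 + M) (graphMap ν φ) := by
  refine LipschitzWith.add (LipschitzWith.subtype_val _) ?_
  refine LipschitzWith.of_dist_le_mul fun x y => ?_
  rw [dist_eq_norm, ← sub_smul, norm_smul, hν, mul_one, ← dist_eq_norm]
  exact hφ.dist_le_mul x y

lemma finrank_orthogonal_unit (hn : 0 < n) {ν : E n} (hν : ‖ν‖ = 1) :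
    Module.finrank ℝ ((ℝ ∙ ν)ᗮ : Submodule ℝ (E n)) = n - 1 := by
  have : Fact (Module.finrank ℝ (E n) = (n - 1) + 1) := ⟨by simp; omega⟩
  exact Submodule.finrank_orthogonal_span_singleton (by rintro rfl; simp at hν)

/-- The surface measure of a Lipschitz graph is bounded by the volume on the hyperplane. -/
lemma setLIntegral_graph_le (hn : 0 < n) {ν : E n} (hν : ‖ν‖ = 1) {M : ℝ≥0}
    {φ : ((ℝ ∙ ν)ᗮ : Submodule ℝ (E n)) → ℝ} (hφ : LipschitzWith M φ) {S : Set (E n)}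
    (hSr : S ⊆ Set.range (graphMap ν φ)) {h : E n → ℝ≥0∞}
    (hh : Measurable h) :
    ∫⁻ x in S, h x ∂(Measure.euclideanHausdorffMeasure (n - 1)) ≤
      (((1 + M) ^ (n - 1) : ℝ≥0) : ℝ≥0∞) *
        ∫⁻ y in graphMap ν φ ⁻¹' S, h (graphMap ν φ y) := by
  have hF := lipschitzWith_graphMap hν hφ
  have hFm : Measurable (graphMap ν φ) := hF.continuous.measurable
  have hle : (Measure.euclideanHausdorffMeasure (n - 1)).restrict S ≤
      ((1 + M) ^ (n - 1) : ℝ≥0) • (volume.restrict (graphMap ν φ ⁻¹' S)).map (graphMap ν φ) := by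
    refine Measure.le_iff.mpr fun A hA => ?_
    rw [Measure.restrict_apply hA, Measure.smul_apply, Measure.map_apply hFm hA,
      Measure.restrict_apply (hFm hA), ← Set.preimage_inter]
    have himg : A ∩ S = graphMap ν φ '' (graphMap ν φ ⁻¹' (A ∩ S)) :=
      (Set.image_preimage_eq_of_subset (Set.inter_subset_right.trans hSr)).symm
    have hvol : (volume : Measure ((ℝ ∙ ν)ᗮ : Submodule ℝ (E n)))
        = Measure.euclideanHausdorffMeasure (n - 1) := by
      rw [← finrank_orthogonal_unit hn hν, InnerProductSpace.euclideanHausdorffMeasure_eq_volume]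
    conv_lhs => rw [himg]
    rw [hvol, Measure.euclideanHausdorffMeasure_def, Measure.euclideanHausdorffMeasure_def,
      Measure.smul_apply, Measure.smul_apply, smul_comm]
    gcongr
    have := hF.hausdorffMeasure_image_le (d := ((n - 1 : ℕ) : ℝ)) (Nat.cast_nonneg _)
      (graphMap ν φ ⁻¹' (A ∩ S))
    rw [ENNReal.rpow_natCast] at this
    refine this.trans_eq ?_
    rw [ENNReal.smul_def, smul_eq_mul]; push_cast; rfl
  calc _ ≤ ∫⁻ x, h x ∂(((1 + M) ^ (n - 1) : ℝ≥0) •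
        (volume.restrict (graphMap ν φ ⁻¹' S)).map (graphMap ν φ)) := lintegral_mono' hle le_rfl
    _ = _ := by rw [lintegral_smul_measure, lintegral_map hh hFm, ENNReal.smul_def, smul_eq_mul]

lemma norm_fderiv_sq_le {F : Type*} [NormedAddCommGroup F] [NormedSpace ℝ F] (ψ : E n → F)
    (x : E n) {ν : E n} (hν : ‖ν‖ = 1) : ‖fderiv ℝ ψ x ν‖ ^ 2 ≤ ∑ i, ‖pd i ψ x‖ ^ 2 := by
  have e : fderiv ℝ ψ x ν = ∑ i, ν i • pd i ψ x := by
    conv_lhs => rw [← (EuclideanSpace.basisFun (Fin n) ℝ).sum_repr ν]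
    simp [pd]
  calc ‖fderiv ℝ ψ x ν‖ ^ 2 ≤ (∑ i, ‖ν i‖ * ‖pd i ψ x‖) ^ 2 := by
        rw [e]
        gcongr
        refine (norm_sum_le _ _).trans_eq ?_
        simp [norm_smul]
    _ ≤ (∑ i, ‖ν i‖ ^ 2) * ∑ i, ‖pd i ψ x‖ ^ 2 := Finset.sum_mul_sq_le_sq_mul_sq _ _ _
    _ = _ := by rw [← EuclideanSpace.norm_sq_eq, hν]; simp

lemma enorm_fderiv_sq_le {F : Type*} [NormedAddCommGroup F] [NormedSpace ℝ F] (ψ : E n → F)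
    (x : E n) {ν : E n} (hν : ‖ν‖ = 1) : ‖fderiv ℝ ψ x ν‖ₑ ^ 2 ≤ ∑ i, ‖pd i ψ x‖ₑ ^ 2 := by
  have := ENNReal.ofReal_le_ofReal (norm_fderiv_sq_le ψ x hν)
  rw [ENNReal.ofReal_sum_of_nonneg fun i _ => by positivity] at this
  simpa only [ENNReal.ofReal_pow (norm_nonneg _), ofReal_norm] using this

/-- The squared length `|ψ|² + |∇ψ|²`. -/
def sobDensity {F : Type*} [NormedAddCommGroup F] [NormedSpace ℝ F] (ψ : E n → F) (x : E n) :
    ℝ≥0∞ := ‖ψ x‖ₑ ^ 2 + ∑ i, ‖pd i ψ x‖ₑ ^ 2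

lemma measurable_sobDensity {F : Type*} [NormedAddCommGroup F] [NormedSpace ℝ F]
    {ψ : E n → F} (hψ : ContDiff ℝ ∞ ψ) : Measurable (sobDensity ψ) := by
  unfold sobDensity
  refine (hψ.continuous.enorm.measurable.pow_const 2).add (Finset.measurable_fun_sum _ fun i _ => ?_)
  exact (continuous_pd_of_contDiff hψ i).enorm.measurable.pow_const 2

/-- In a chart, boundary points lie on the graph. -/
lemma mem_graph_of_mem_frontier {Ω U : Set (E n)} (hΩ : IsOpen Ω) (hU : IsOpen U) {ν : E n}
    {φ : ((ℝ ∙ ν)ᗮ : Submodule ℝ (E n)) → ℝ} (hφ : Continuous φ)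
    (hUD : U ∩ Ω = U ∩ {x | φ ((ℝ ∙ ν)ᗮ.orthogonalProjectionOnto x) < inner ℝ ν x})
    {x : E n} (hx : x ∈ frontier Ω) (hxU : x ∈ U) :
    φ ((ℝ ∙ ν)ᗮ.orthogonalProjectionOnto x) = inner ℝ ν x := by
  have hc1 : Continuous fun x : E n => φ ((ℝ ∙ ν)ᗮ.orthogonalProjectionOnto x) :=
    hφ.comp (ContinuousLinearMap.continuous _)
  have hc2 : Continuous fun x : E n => inner ℝ ν x := by fun_prop
  apply le_antisymm
  · have h1 : x ∈ closure (U ∩ Ω) :=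
      hU.inter_closure ⟨hxU, frontier_subset_closure hx⟩
    have h2 : closure (U ∩ Ω) ⊆
        {x | φ ((ℝ ∙ ν)ᗮ.orthogonalProjectionOnto x) ≤ inner ℝ ν x} := by
      refine closure_minimal ?_ (isClosed_le hc1 hc2)
      rw [hUD]
      intro y hy
      have hy2 : φ ((ℝ ∙ ν)ᗮ.orthogonalProjectionOnto y) < inner ℝ ν y := hy.2
      exact hy2.le
    exact h2 h1
  · by_contra! hlt
    have : x ∈ U ∩ Ω := by rw [hUD]; exact ⟨hxU, hlt⟩
    rw [hΩ.frontier_eq] at hx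
    exact hx.2 this.2

lemma orthogonalProjectionOnto_add_smul (ν x : E n) (t : ℝ) :
    (ℝ ∙ ν)ᗮ.orthogonalProjectionOnto (x + t • ν) = (ℝ ∙ ν)ᗮ.orthogonalProjectionOnto x := by
  rw [map_add, map_smul, Submodule.orthogonalProjectionOnto_orthogonal_apply_eq_zero
    (Submodule.mem_span_singleton_self ν)]
  simp

lemma graphMap_orthogonalProjectionOnto {ν : E n} (hν : ‖ν‖ = 1)
    {φ : ((ℝ ∙ ν)ᗮ : Submodule ℝ (E n)) → ℝ} {x : E n}
    (hx : φ ((ℝ ∙ ν)ᗮ.orthogonalProjectionOnto x) = inner ℝ ν x) :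
    graphMap ν φ ((ℝ ∙ ν)ᗮ.orthogonalProjectionOnto x) = x := by
  have h := (ℝ ∙ ν).starProjection_add_starProjection_orthogonal x
  rw [Submodule.starProjection_unit_singleton ℝ hν] at h
  rw [graphMap, hx, add_comm]
  exact h

/-- The trace inequality in one chart. -/
lemma trace_inequality_chart (hn : 0 < n) {Ω U : Set (E n)} (hΩ : IsOpen Ω) (hU : IsOpen U)
    {M : ℝ≥0} {D : Set (E n)} (hD : IsSpecialLipschitz M D) (hUD : U ∩ Ω = U ∩ D) {ε : ℝ}
    (hε : 0 < ε) {F : Type*} [NormedAddCommGroup F] [NormedSpace ℝ F] [CompleteSpace F]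
    {ψ : E n → F} (hψ : ContDiff ℝ ∞ ψ) :
    ENNReal.ofReal ε * ∫⁻ x in {x ∈ frontier Ω | Metric.ball x ε ⊆ U}, ‖ψ x‖ₑ ^ 2
        ∂(Measure.euclideanHausdorffMeasure (n - 1)) ≤
      (((1 + M) ^ (n - 1) : ℝ≥0) : ℝ≥0∞) * (2 * (1 + ENNReal.ofReal ε ^ 2)) *
        ∫⁻ x in U ∩ Ω, sobDensity ψ x := by
  obtain ⟨ν, φ, hν, hφ, rfl⟩ := hD
  set S := {x ∈ frontier Ω | Metric.ball x ε ⊆ U} with hSdef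
  have hgraph : ∀ x ∈ S, φ ((ℝ ∙ ν)ᗮ.orthogonalProjectionOnto x) = inner ℝ ν x := fun x hx =>
    mem_graph_of_mem_frontier hΩ hU hφ.continuous hUD hx.1 (hx.2 (Metric.mem_ball_self hε))
  have hSc : IsClosed S := by
    refine isClosed_frontier.inter (isClosed_of_closure_subset fun x hx y hy => ?_)
    obtain ⟨z, hz, hzx⟩ := Metric.mem_closure_iff.mp hx (ε - dist y x)
      (sub_pos.mpr (Metric.mem_ball.mp hy))
    refine hz (Metric.mem_ball.mpr ?_)
    have := dist_triangle y x z
    linarith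
  have hSr : S ⊆ Set.range (graphMap ν φ) := fun x hx =>
    ⟨_, graphMap_orthogonalProjectionOnto hν (hgraph x hx)⟩
  have hUΩ : MeasurableSet (U ∩ Ω) := (hU.inter hΩ).measurableSet
  set G : E n → ℝ≥0∞ := (U ∩ Ω).indicator (sobDensity ψ) with hG
  have hGm : Measurable G := (measurable_sobDensity hψ).indicator hUΩ
  have hseg : ∀ x ∈ S, ∀ t ∈ Set.Ioo 0 ε, x + t • ν ∈ U ∩ Ω := by
    intro x hx t ht
    rw [hUD]
    refine ⟨hx.2 ?_, ?_⟩
    · rw [Metric.mem_ball, dist_eq_norm, add_sub_cancel_left, norm_smul, hν, mul_one,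
        Real.norm_of_nonneg ht.1.le]
      exact ht.2
    · rw [Set.mem_ofPred_eq, orthogonalProjectionOnto_add_smul, hgraph x hx, inner_add_right,
        inner_smul_right, real_inner_self_eq_norm_sq, hν]
      linarith [ht.1]
  have hline : ∀ x ∈ S, ENNReal.ofReal ε * ‖ψ x‖ₑ ^ 2 ≤
      2 * (1 + ENNReal.ofReal ε ^ 2) * ∫⁻ t : ℝ, G (x + t • ν) := by
    intro x hx
    have hf : ContDiff ℝ 1 fun t : ℝ => ψ (x + t • ν) :=
      (hψ.of_le (by norm_cast)).comp (by fun_prop)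
    have hderiv : ∀ t : ℝ, deriv (fun t : ℝ => ψ (x + t • ν)) t = fderiv ℝ ψ (x + t • ν) ν := by
      intro t
      have h1 : HasDerivAt (fun t : ℝ => x + t • ν) ν t := by
        simpa using ((hasDerivAt_id t).smul_const ν).const_add x
      exact ((hψ.differentiable (by simp) (x + t • ν)).hasFDerivAt.comp_hasDerivAt t h1).deriv
    have h := enorm_sq_le_lintegral_Ioo hf ε
    simp only [zero_smul, add_zero, hderiv] at h
    refine h.trans ?_
    rw [mul_assoc, add_mul, one_mul]
    have hA : ∀ g : ℝ → ℝ≥0∞, (∀ t, g t ≤ sobDensity ψ (x + t • ν)) →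
        ∫⁻ t in Set.Ioo 0 ε, g t ≤ ∫⁻ t : ℝ, G (x + t • ν) := by
      intro g hg
      refine (setLIntegral_mono' measurableSet_Ioo fun t ht => ?_).trans
        (setLIntegral_le_lintegral (Set.Ioo 0 ε) _)
      rw [hG, Set.indicator_of_mem (hseg x hx t ht)]
      exact hg t
    refine mul_le_mul_right (add_le_add (hA _ fun t => le_self_add)
      (mul_le_mul_right ?_ _)) _
    · exact hA _ fun t => (enorm_fderiv_sq_le ψ _ hν).trans le_add_self
  calc _ ≤ ENNReal.ofReal ε * ((((1 + M) ^ (n - 1) : ℝ≥0) : ℝ≥0∞) *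
        ∫⁻ y in graphMap ν φ ⁻¹' S, ‖ψ (graphMap ν φ y)‖ₑ ^ 2) := by
        gcongr
        exact setLIntegral_graph_le hn hν hφ hSr
          (hψ.continuous.enorm.measurable.pow_const 2)
    _ = (((1 + M) ^ (n - 1) : ℝ≥0) : ℝ≥0∞) *
        ∫⁻ y in graphMap ν φ ⁻¹' S, ENNReal.ofReal ε * ‖ψ (graphMap ν φ y)‖ₑ ^ 2 := by
        rw [lintegral_const_mul' _ _ ENNReal.ofReal_ne_top]; ring
    _ ≤ (((1 + M) ^ (n - 1) : ℝ≥0) : ℝ≥0∞) * ∫⁻ y, 2 * (1 + ENNReal.ofReal ε ^ 2) *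
          ∫⁻ t : ℝ, G (graphMap ν φ y + t • ν) := by
        refine mul_le_mul_right ?_ _
        refine (setLIntegral_mono' ((lipschitzWith_graphMap hν hφ).continuous.measurable
          hSc.measurableSet) fun y hy => ?_).trans (setLIntegral_le_lintegral _ _)
        exact hline _ hy
    _ = _ := by
        rw [lintegral_const_mul' _ _ (by finiteness)]
        have := lintegral_lintegral_graph hν hGm φ
        unfold graphMap
        rw [this, hG, lintegral_indicator hUΩ, ← mul_assoc]

/-- The trace inequality on a minimally smooth domain. -/
theorem exists_trace_inequality (hn : 0 < n) {Ω : Set (E n)} (hΩ : IsMinimallySmooth Ω) :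
    ∃ C : ℝ≥0, ∀ ψ : E n → Clif n, ContDiff ℝ ∞ ψ →
      ∫⁻ x, ‖ψ x‖ₑ ^ 2 ∂(surf Ω) ≤ C * ∫⁻ x in Ω, sobDensity ψ x := by
  obtain ⟨hΩo, ε, N, M, U, hε, hUo, hcov, hN, hloc⟩ := hΩ
  set K : ℝ≥0∞ := (((1 + M) ^ (n - 1) : ℝ≥0) : ℝ≥0∞) * (2 * (1 + ENNReal.ofReal ε ^ 2)) with hK
  have hKt : K ≠ ⊤ := by rw [hK]; finiteness
  have hε' : ENNReal.ofReal ε ≠ 0 := by simpa using hε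
  refine ⟨((ENNReal.ofReal ε)⁻¹ * (K * N)).toNNReal, fun ψ hψ => ?_⟩
  rw [ENNReal.coe_toNNReal (by finiteness)]
  have hm := measurable_sobDensity hψ
  have h1 : ENNReal.ofReal ε * ∫⁻ x, ‖ψ x‖ₑ ^ 2 ∂(surf Ω) ≤
      K * N * ∫⁻ x in Ω, sobDensity ψ x := by
    calc _ ≤ ENNReal.ofReal ε * ∑' k, ∫⁻ x in {x ∈ frontier Ω | Metric.ball x ε ⊆ U k},
          ‖ψ x‖ₑ ^ 2 ∂(Measure.euclideanHausdorffMeasure (n - 1)) := by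
          gcongr
          refine (lintegral_mono_set ?_).trans (lintegral_iUnion_le _ _)
          intro x hx
          obtain ⟨k, hk⟩ := hcov x hx
          exact Set.mem_iUnion.mpr ⟨k, hx, hk⟩
      _ ≤ ∑' k, K * ∫⁻ x in U k ∩ Ω, sobDensity ψ x := by
          rw [← ENNReal.tsum_mul_left]
          refine ENNReal.tsum_le_tsum fun k => ?_
          obtain ⟨D, hD, hUD⟩ := hloc k
          exact trace_inequality_chart hn hΩo (hUo k) hD hUD hε hψ
      _ = K * ∫⁻ x in Ω, ∑' k, (U k).indicator (sobDensity ψ) x := by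
          rw [ENNReal.tsum_mul_left, lintegral_tsum fun k =>
            (hm.indicator (hUo k).measurableSet).aemeasurable]
          congr 2; ext1 k
          rw [lintegral_indicator (hUo k).measurableSet,
            Measure.restrict_restrict (hUo k).measurableSet]
      _ ≤ K * ∫⁻ x in Ω, N * sobDensity ψ x := by
          gcongr with x
          have : ∀ k, (U k).indicator (sobDensity ψ) x =
              {k | x ∈ U k}.indicator (fun _ => sobDensity ψ x) k := by
            intro k; by_cases hk : x ∈ U k <;> simp [Set.indicator, hk]
          simp_rw [this]
          rw [← tsum_subtype, ENNReal.tsum_const]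
          gcongr
          have := hN x
          rw [ENat.card_coe_set_eq]
          exact_mod_cast this
      _ = _ := by rw [lintegral_const_mul _ hm, ← mul_assoc]
  calc _ = (ENNReal.ofReal ε)⁻¹ * (ENNReal.ofReal ε * ∫⁻ x, ‖ψ x‖ₑ ^ 2 ∂(surf Ω)) := by
        rw [← mul_assoc, ENNReal.inv_mul_cancel hε' ENNReal.ofReal_ne_top, one_mul]
    _ ≤ _ := by
        rw [mul_assoc]
        gcongr

end TraceInequality

/-! ### Mollification in `L²` -/

section Mollification

lemma eLpNorm_two_sq {α F : Type*} [MeasurableSpace α] [NormedAddCommGroup F] {μ : Measure α}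
    (f : α → F) : eLpNorm f 2 μ ^ 2 = ∫⁻ x, ‖f x‖ₑ ^ 2 ∂μ := by
  rw [eLpNorm_eq_lintegral_rpow_enorm_toReal (by norm_num) (by norm_num), ← ENNReal.rpow_natCast,
    ← ENNReal.rpow_mul]
  simp

lemma tendsto_zero_of_sq {ι : Type*} {l : Filter ι} {f : ι → ℝ≥0∞}
    (h : Tendsto (fun k => f k ^ 2) l (𝓝 0)) : Tendsto f l (𝓝 0) := by
  have := h.ennrpow_const (1 / 2)
  simp only [← ENNReal.rpow_natCast, ← ENNReal.rpow_mul] at this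
  simpa using this

/-- Bounded multipliers which tend to zero pointwise tend to zero strongly on `L²`. -/
lemma tendsto_eLpNorm_smul_zero {α F : Type*} [MeasurableSpace α] [NormedAddCommGroup F]
    [NormedSpace ℝ F] {μ : Measure α} {u : α → F} (hu : MemLp u 2 μ) {h : ℕ → α → ℝ} {C : ℝ}
    (hm : ∀ k, Measurable (h k)) (hC : ∀ k x, |h k x| ≤ C)
    (h0 : ∀ x, Tendsto (fun k => h k x) atTop (𝓝 0)) :
    Tendsto (fun k => eLpNorm (fun x => h k x • u x) 2 μ) atTop (𝓝 0) := by
  apply tendsto_zero_of_sq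
  simp_rw [eLpNorm_two_sq, enorm_smul, mul_pow]
  have hue : AEMeasurable (fun x => ‖u x‖ₑ ^ 2) μ := hu.1.enorm.pow_const 2
  have hfin : ∫⁻ x, ‖u x‖ₑ ^ 2 ∂μ ≠ ⊤ := by
    rw [← eLpNorm_two_sq]; exact ENNReal.pow_ne_top hu.2.ne
  have key := tendsto_lintegral_of_dominated_convergence' (μ := μ)
    (F := fun k x => ‖h k x‖ₑ ^ 2 * ‖u x‖ₑ ^ 2) (f := fun _ => 0)
    (fun x => ENNReal.ofReal C ^ 2 * ‖u x‖ₑ ^ 2)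
    (fun k => ((hm k).enorm.pow_const 2).aemeasurable.mul hue)
    (fun k => .of_forall fun x => ?_) ?_ ?_
  · simpa using key
  · dsimp only
    gcongr
    rw [← ofReal_norm, Real.norm_eq_abs]
    exact ENNReal.ofReal_le_ofReal (hC k x)
  · rw [lintegral_const_mul' _ _ (by finiteness)]
    exact ENNReal.mul_ne_top (by finiteness) hfin
  · have hux : ∀ᵐ x ∂μ, ‖u x‖ₑ ^ 2 < ⊤ := ae_lt_top' hue hfin
    filter_upwards [hux] with x hx
    have h1 : Tendsto (fun k => ‖h k x‖ₑ ^ 2) atTop (𝓝 0) := by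
      have := ENNReal.Tendsto.pow (n := 2) (h0 x).enorm
      simpa using this
    simpa using ENNReal.Tendsto.mul_const h1 (Or.inr hx.ne)

variable {n : ℕ} {F : Type*} [NormedAddCommGroup F]

/-- Translations are continuous on `L²`. -/
lemma tendsto_eLpNorm_translate {W : E n → F} (hW : MemLp W 2 volume) :
    Tendsto (fun y => eLpNorm (fun x => W (x - y) - W x) 2 volume) (𝓝 0) (𝓝 0) := by
  have hf : Fact ((2 : ℝ≥0∞) ≠ ⊤) := ⟨by norm_num⟩
  have hc : Continuous fun y : E n => DomAddAct.mk (-y) +ᵥ hW.toLp W :=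
    (DomAddAct.continuous_mk.comp continuous_neg).vadd continuous_const
  have h := hc.tendsto 0
  rw [neg_zero, DomAddAct.mk_zero, zero_vadd] at h
  simp_rw [DomAddAct.mk_vadd_toLp] at h
  rw [Lp.tendsto_Lp_iff_tendsto_eLpNorm''] at h
  refine h.congr fun y => ?_
  congr 1; ext1 x
  simp only [Pi.sub_apply, vadd_eq_add]
  rw [neg_add_eq_sub]

variable [NormedSpace ℝ F]

/-- The mollification error is bounded by the modulus of continuity of the translations. -/
lemma eLpNorm_mollify_sub_le [CompleteSpace F] {W : E n → F} (hWm : StronglyMeasurable W)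
    (hW : MemLp W 2 volume) {ρ : E n → ℝ} (hρc : Continuous ρ) (hρs : HasCompactSupport ρ)
    (hρ0 : ∀ y, 0 ≤ ρ y) (hρ1 : ∫ y, ρ y = 1) {δ : ℝ≥0∞}
    (hδ : ∀ y ∈ Function.support ρ, eLpNorm (fun x => W (x - y) - W x) 2 volume ≤ δ) :
    eLpNorm (fun x => (∫ y, ρ y • W (x - y)) - W x) 2 volume ≤ δ := by
  have hρi : Integrable ρ := hρc.integrable_of_hasCompactSupport hρs
  have hρe : ∫⁻ y, ‖ρ y‖ₑ = 1 := by
    have := ofReal_integral_eq_lintegral_ofReal hρi (.of_forall hρ0)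
    rw [hρ1, ENNReal.ofReal_one] at this
    rw [this]
    exact lintegral_congr fun y => by rw [← ofReal_norm, Real.norm_of_nonneg (hρ0 y)]
  have hloc : LocallyIntegrable W volume := hW.locallyIntegrable (by norm_num)
  have hex : ∀ x, Integrable fun y => ρ y • W (x - y) := fun x =>
    hρs.convolutionExists_left (ContinuousLinearMap.lsmul ℝ ℝ) hρc hloc x
  have hρm : Measurable fun y => ‖ρ y‖ₑ := hρc.enorm.measurable
  have hDm : StronglyMeasurable fun p : E n × E n => W (p.1 - p.2) - W p.1 :=
    (hWm.comp_measurable (measurable_fst.sub measurable_snd)).sub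
      (hWm.comp_measurable measurable_fst)
  have hpt : ∀ x, ‖(∫ y, ρ y • W (x - y)) - W x‖ₑ ^ 2 ≤
      ∫⁻ y, ‖ρ y‖ₑ * ‖W (x - y) - W x‖ₑ ^ 2 := by
    intro x
    have hDx : Measurable fun y => ‖W (x - y) - W x‖ₑ :=
      (hDm.comp_measurable measurable_prodMk_left).enorm
    have e : (∫ y, ρ y • W (x - y)) - W x = ∫ y, ρ y • (W (x - y) - W x) := by
      simp_rw [smul_sub]
      rw [integral_sub (hex x) (hρi.smul_const _), integral_smul_const, hρ1, one_smul]
    rw [e]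
    have hwd : (volume.withDensity fun y => ‖ρ y‖ₑ) Set.univ = 1 := by
      rw [withDensity_apply _ MeasurableSet.univ, Measure.restrict_univ, hρe]
    calc _ ≤ (∫⁻ y, ‖ρ y • (W (x - y) - W x)‖ₑ) ^ 2 := by
          gcongr; exact enorm_integral_le_lintegral_enorm _
      _ = (∫⁻ y, ‖W (x - y) - W x‖ₑ ∂(volume.withDensity fun y => ‖ρ y‖ₑ)) ^ 2 := by
          rw [lintegral_withDensity_eq_lintegral_mul _ hρm hDx]
          simp_rw [enorm_smul]; rfl
      _ ≤ _ := by
          refine (sq_lintegral_le hDx.aemeasurable).trans_eq ?_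
          rw [hwd, one_mul, lintegral_withDensity_eq_lintegral_mul _ hρm (hDx.pow_const 2)]
          rfl
  have hsq : eLpNorm (fun x => (∫ y, ρ y • W (x - y)) - W x) 2 volume ^ 2 ≤ δ ^ 2 := by
    rw [eLpNorm_two_sq]
    calc _ ≤ ∫⁻ x, ∫⁻ y, ‖ρ y‖ₑ * ‖W (x - y) - W x‖ₑ ^ 2 := lintegral_mono hpt
      _ = ∫⁻ y, ∫⁻ x, ‖ρ y‖ₑ * ‖W (x - y) - W x‖ₑ ^ 2 := by
          apply lintegral_lintegral_swap
          exact ((hρm.comp measurable_snd).mul (hDm.enorm.pow_const 2)).aemeasurable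
      _ ≤ ∫⁻ y, ‖ρ y‖ₑ * δ ^ 2 := by
          refine lintegral_mono fun y => ?_
          rw [lintegral_const_mul' _ _ (by finiteness), ← eLpNorm_two_sq]
          by_cases hy : ρ y = 0
          · simp [hy]
          · gcongr
            exact hδ y hy
      _ = δ ^ 2 := by rw [lintegral_mul_const _ hρm, hρe, one_mul]
  exact (ENNReal.pow_le_pow_left_iff two_ne_zero).mp hsq

/-- Mollification converges in `L²` if the supports of the kernels shrink to the origin. -/
lemma tendsto_eLpNorm_mollify [CompleteSpace F] {W : E n → F} (hWm : StronglyMeasurable W)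
    (hW : MemLp W 2 volume) {ρ : ℕ → E n → ℝ} (hρc : ∀ k, Continuous (ρ k))
    (hρs : ∀ k, HasCompactSupport (ρ k)) (hρ0 : ∀ k y, 0 ≤ ρ k y) (hρ1 : ∀ k, ∫ y, ρ k y = 1)
    {R : ℕ → ℝ} (hR : Tendsto R atTop (𝓝 0))
    (hρR : ∀ k, Function.support (ρ k) ⊆ Metric.closedBall 0 (R k)) :
    Tendsto (fun k => eLpNorm (fun x => (∫ y, ρ k y • W (x - y)) - W x) 2 volume)
      atTop (𝓝 0) := by
  rw [ENNReal.tendsto_nhds_zero]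
  intro δ hδ
  have h := ENNReal.tendsto_nhds_zero.mp (tendsto_eLpNorm_translate hW) δ hδ
  obtain ⟨r, hr, hball⟩ := Metric.eventually_nhds_iff_ball.mp h
  filter_upwards [hR.eventually (gt_mem_nhds hr)] with k hk
  refine eLpNorm_mollify_sub_le hWm hW (hρc k) (hρs k) (hρ0 k) (hρ1 k) fun y hy => hball y ?_
  exact Metric.closedBall_subset_ball hk (hρR k hy)

end Mollification

/-! ### Density of smooth functions in `H¹(Ω)` -/

section Density

variable {n : ℕ} {Ω : Set (E n)}

/-- A uniform interior cone condition near the point `x₀`. -/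
def HasConeAt (Ω : Set (E n)) (x₀ : E n) : Prop :=
  ∃ (r κ : ℝ) (ν : E n), 0 < r ∧ 0 < κ ∧ κ ≤ 1 ∧ ‖ν‖ ≤ 1 ∧
    ∀ x ∈ Ω ∩ Metric.ball x₀ r, ∀ t ∈ Set.Ioo 0 r, Metric.closedBall (x + t • ν) (κ * t) ⊆ Ω

lemma IsSpecialLipschitz.closedBall_subset {M : ℝ≥0} {D : Set (E n)} (hD : IsSpecialLipschitz M D) :
    ∃ (κ : ℝ) (ν : E n), 0 < κ ∧ κ ≤ 1 ∧ ‖ν‖ ≤ 1 ∧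
      ∀ x ∈ D, ∀ t, 0 < t → Metric.closedBall (x + t • ν) (κ * t) ⊆ D := by
  obtain ⟨ν, φ, hν, hφ, rfl⟩ := hD
  have hM : (0 : ℝ) ≤ M := M.2
  refine ⟨1 / (1 + M), ν, by positivity, ?_, hν.le, fun x hx t ht z hz => ?_⟩
  · rw [div_le_one (by positivity)]; linarith
  · rw [Metric.mem_closedBall, dist_eq_norm] at hz
    have hx' : φ ((ℝ ∙ ν)ᗮ.orthogonalProjectionOnto x) < inner ℝ ν x := hx
    change φ ((ℝ ∙ ν)ᗮ.orthogonalProjectionOnto z) < inner ℝ ν z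
    set w := z - (x + t • ν) with hw
    have hzw : z = x + t • ν + w := by rw [hw]; abel
    have h1 : |φ ((ℝ ∙ ν)ᗮ.orthogonalProjectionOnto z) -
        φ ((ℝ ∙ ν)ᗮ.orthogonalProjectionOnto x)| ≤ M * ‖w‖ := by
      have := hφ.dist_le_mul ((ℝ ∙ ν)ᗮ.orthogonalProjectionOnto z)
        ((ℝ ∙ ν)ᗮ.orthogonalProjectionOnto x)
      rw [Real.dist_eq] at this
      refine this.trans ?_
      gcongr
      rw [dist_eq_norm, hzw, map_add, orthogonalProjectionOnto_add_smul, add_sub_cancel_left]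
      exact Submodule.norm_orthogonalProjectionOnto_apply_le _ _
    have h2 : |inner ℝ ν w| ≤ ‖w‖ := by
      have := abs_real_inner_le_norm ν w
      rwa [hν, one_mul] at this
    have h3 : inner ℝ ν z = inner ℝ ν x + t + inner ℝ ν w := by
      rw [hzw, inner_add_right, inner_add_right, inner_smul_right, real_inner_self_eq_norm_sq, hν]
      ring
    have h4 : (1 + M) * ‖w‖ ≤ t := by
      calc (1 + M) * ‖w‖ ≤ (1 + M) * (1 / (1 + M) * t) := by gcongr
        _ = t := by field_simp
    rw [h3]
    have := (abs_le.mp h1).2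
    have := (abs_le.mp h2).1
    linarith

lemma IsMinimallySmooth.hasConeAt (hΩ : IsMinimallySmooth Ω) (x₀ : E n) : HasConeAt Ω x₀ := by
  obtain ⟨hΩo, ε, N, M, U, hε, hUo, hcov, hN, hloc⟩ := hΩ
  have hclose : ∀ {r κ t : ℝ} {ν x z : E n}, x ∈ Metric.ball x₀ r → t ∈ Set.Ioo 0 r → κ ≤ 1 →
      ‖ν‖ ≤ 1 → z ∈ Metric.closedBall (x + t • ν) (κ * t) → z ∈ Metric.ball x₀ (3 * r) := by
    intro r κ t ν x z hx ht hκ hν hz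
    rw [Metric.mem_ball] at hx ⊢
    rw [Metric.mem_closedBall] at hz
    have h1 : dist (x + t • ν) x ≤ t := by
      rw [dist_eq_norm, add_sub_cancel_left, norm_smul, Real.norm_of_nonneg ht.1.le]
      exact mul_le_of_le_one_right ht.1.le hν
    have h2 : κ * t ≤ t := mul_le_of_le_one_left ht.1.le hκ
    have := dist_triangle4 z (x + t • ν) x x₀
    linarith [ht.2]
  by_cases h1 : x₀ ∈ Ω
  · obtain ⟨r, hr, hball⟩ := Metric.isOpen_iff.mp hΩo x₀ h1
    refine ⟨r / 3, 1, 0, by positivity, one_pos, le_rfl, by simp, fun x hx t ht z hz => ?_⟩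
    have := hclose hx.2 ht le_rfl (by simp) hz
    rw [mul_div_cancel₀ r three_ne_zero] at this
    exact hball this
  by_cases h2 : x₀ ∈ closure Ω
  · obtain ⟨k, hk⟩ := hcov x₀ (by rw [hΩo.frontier_eq]; exact ⟨h2, h1⟩)
    obtain ⟨D, hD, hUD⟩ := hloc k
    obtain ⟨κ, ν, hκ, hκ1, hν, hcone⟩ := hD.closedBall_subset
    refine ⟨ε / 3, κ, ν, by positivity, hκ, hκ1, hν, fun x hx t ht z hz => ?_⟩
    have hzU : z ∈ U k := by
      have := hclose hx.2 ht hκ1 hν hz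
      rw [mul_div_cancel₀ ε three_ne_zero] at this
      exact hk this
    have hxD : x ∈ U k ∩ D := by
      rw [← hUD]
      exact ⟨hk (Metric.ball_subset_ball (by linarith) hx.2), hx.1⟩
    have : z ∈ U k ∩ Ω := by rw [hUD]; exact ⟨hzU, hcone x hxD.2 t ht.1 hz⟩
    exact this.2
  · obtain ⟨r, hr, hball⟩ := Metric.isOpen_iff.mp isClosed_closure.isOpen_compl x₀ h2
    refine ⟨r, 1, 0, hr, one_pos, le_rfl, by simp, fun x hx => ?_⟩
    exact absurd (subset_closure hx.1) (hball hx.2)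

/-- The derivative of a mollification, if the reflected translate of the kernel satisfies the
integration by parts formula. -/
lemma pd_mollify {i : Fin n} {u g : E n → Clif n} (hΩ : MeasurableSet Ω)
    (hu : LocallyIntegrable (Ω.indicator u) volume) {ρ : E n → ℝ} (hρ : ContDiff ℝ ∞ ρ)
    (hρs : HasCompactSupport ρ) {x : E n}
    (h : ∫ y in Ω, pd i (fun y => ρ (x - y)) y • u y = -∫ y in Ω, ρ (x - y) • g y) :
    pd i (fun x => ∫ y, ρ y • Ω.indicator u (x - y)) x =
      ∫ y, ρ y • Ω.indicator g (x - y) := by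
  set W := Ω.indicator u
  have hpd : ∀ y, pd i (fun y => ρ (x - y)) y = -pd i ρ (x - y) := by
    intro y
    have h1 : HasFDerivAt (fun y => x - y) (-ContinuousLinearMap.id ℝ (E n)) y :=
      (hasFDerivAt_id y).const_sub x
    have h2 : HasFDerivAt (fun y => ρ (x - y)) _ y :=
      (hρ.differentiable (by simp) (x - y)).hasFDerivAt.comp y h1
    unfold pd
    rw [h2.fderiv]
    simp
  have hconv : (fun x => ∫ y, ρ y • W (x - y)) =
      convolution ρ W (ContinuousLinearMap.lsmul ℝ ℝ) volume := rfl
  have hfd := hρs.hasFDerivAt_convolution_left (ContinuousLinearMap.lsmul ℝ ℝ)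
    (hρ.of_le (by norm_cast)) hu x
  have hint := (hρs.fderiv ℝ).convolutionExists_left
    (ContinuousLinearMap.precompL (E n) (ContinuousLinearMap.lsmul ℝ ℝ (E := Clif n)))
    (hρ.continuous_fderiv (by simp)) hu x
  have e1 : pd i (fun x => ∫ y, ρ y • W (x - y)) x = ∫ y, pd i ρ y • W (x - y) := by
    rw [hconv, pd, hfd.fderiv, convolution_def, ContinuousLinearMap.integral_apply hint]
    rfl
  have flip : ∀ (θ : E n → ℝ) (v : E n → Clif n),
      ∫ y, θ y • Ω.indicator v (x - y) = ∫ y in Ω, θ (x - y) • v y := by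
    intro θ v
    have e := integral_sub_left_eq_self (fun y => θ (x - y) • Ω.indicator v y) volume x
    simp only [sub_sub_cancel] at e
    rw [e, ← integral_indicator hΩ]
    congr 1; ext1 y
    by_cases hy : y ∈ Ω <;> simp [hy]
  rw [e1, flip, flip]
  simp_rw [hpd, neg_smul] at h
  rw [integral_neg, neg_inj] at h
  exact h

/-- Localized elements of `H¹(Ω)` are limits of smooth functions, near points with a cone
condition. -/
lemma mulH1_mem_closure_of_cone (hΩ : IsOpen Ω) {x₀ ν : E n} {r κ : ℝ} (hr : 0 < r) (hκ : 0 < κ)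
    (hκ1 : κ ≤ 1) (hν : ‖ν‖ ≤ 1)
    (hcone : ∀ x ∈ Ω ∩ Metric.ball x₀ r, ∀ t ∈ Set.Ioo 0 r,
      Metric.closedBall (x + t • ν) (κ * t) ⊆ Ω)
    {η : E n → ℝ} (hη : ContDiff ℝ ∞ η) (hηc : HasCompactSupport η)
    (hηs : tsupport η ⊆ Metric.ball x₀ (r / 2)) (w : H1 Ω) :
    mulH1 hη hηc w ∈ (LinearMap.range (ofSmooth Ω)).topologicalClosure := by
  set t : ℕ → ℝ := fun k => r / 4 * (1 / ((k : ℝ) + 1)) with ht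
  have ht0 : ∀ k, 0 < t k := fun k => by positivity
  have htr : ∀ k, t k ≤ r / 4 := fun k => by
    refine mul_le_of_le_one_right (by positivity) ?_
    rw [div_le_one (by positivity)]
    linarith [(Nat.cast_nonneg k : (0 : ℝ) ≤ k)]
  have htl : Tendsto t atTop (𝓝 0) := by
    simpa [ht] using tendsto_one_div_add_atTop_nhds_zero_nat.const_mul (r / 4)
  let f : ∀ k, ContDiffBump (-(t k • ν)) := fun k =>
    ⟨κ * t k / 2, κ * t k, by have := ht0 k; positivity, by have := mul_pos hκ (ht0 k); linarith⟩
  set ρ : ℕ → E n → ℝ := fun k => (f k).normed volume with hρ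
  have hρd : ∀ k, ContDiff ℝ ∞ (ρ k) := fun k => (f k).contDiff_normed
  have hρs : ∀ k, HasCompactSupport (ρ k) := fun k => (f k).hasCompactSupport_normed
  have hρt : ∀ k, tsupport (ρ k) = Metric.closedBall (-(t k • ν)) (κ * t k) := fun k =>
    (f k).tsupport_normed_eq
  have hρR : ∀ k, Function.support (ρ k) ⊆ Metric.closedBall 0 (2 * t k) := by
    intro k
    refine (subset_tsupport _).trans ?_
    rw [hρt]
    refine Metric.closedBall_subset_closedBall' ?_
    rw [dist_zero_right, norm_neg, norm_smul, Real.norm_of_nonneg (ht0 k).le]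
    have h1 := mul_le_of_le_one_right (ht0 k).le hν
    have h2 := mul_le_of_le_one_left (ht0 k).le hκ1
    linarith
  set u : E n → Clif n := fun x => η x • fn w x with hu
  set g : Fin n → E n → Clif n := fun i x => η x • der w i x + pd i η x • fn w x with hg
  have hum : MemLp u 2 (volume.restrict Ω) := memLp_smul_L2 hη.continuous hηc _
  have hgm : ∀ i, MemLp (g i) 2 (volume.restrict Ω) := fun i =>
    (memLp_smul_L2 hη.continuous hηc _).add (memLp_smul_L2
      (continuous_pd_of_contDiff hη i) (hasCompactSupport_pd_of hηc i) _)
  have hweak : ∀ i, IsWeakDeriv Ω i u (g i) := fun i => (isWeakDeriv_der w i).smul hη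
  have hus : StronglyMeasurable (Ω.indicator u) :=
    (hη.continuous.stronglyMeasurable.smul (Lp.stronglyMeasurable _)).indicator hΩ.measurableSet
  have hgs : ∀ i, StronglyMeasurable (Ω.indicator (g i)) := fun i =>
    ((hη.continuous.stronglyMeasurable.smul (Lp.stronglyMeasurable _)).add
      ((continuous_pd_of_contDiff hη i).stronglyMeasurable.smul
        (Lp.stronglyMeasurable _))).indicator hΩ.measurableSet
  have huM : MemLp (Ω.indicator u) 2 volume :=
    (memLp_indicator_iff_restrict hΩ.measurableSet).mpr hum
  have hgM : ∀ i, MemLp (Ω.indicator (g i)) 2 volume := fun i =>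
    (memLp_indicator_iff_restrict hΩ.measurableSet).mpr (hgm i)
  have hul : LocallyIntegrable (Ω.indicator u) volume := huM.locallyIntegrable (by norm_num)
  have hucs : HasCompactSupport (Ω.indicator u) := by
    refine HasCompactSupport.intro hηc fun x hx => ?_
    by_cases hxΩ : x ∈ Ω
    · simp [hxΩ, hu, image_eq_zero_of_notMem_tsupport hx]
    · simp [hxΩ]
  let φ : ℕ → Smooth n := fun k => ⟨fun x => ∫ y, ρ k y • Ω.indicator u (x - y),
    (hρs k).contDiff_convolution_left (ContinuousLinearMap.lsmul ℝ ℝ) (hρd k) hul,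
    (hρs k).convolution (ContinuousLinearMap.lsmul ℝ ℝ) hucs⟩
  have hθs : ∀ k x, tsupport (fun y => ρ k (x - y)) ⊆
      Metric.closedBall (x + t k • ν) (κ * t k) := by
    intro k x
    refine closure_minimal (fun y hy => ?_) Metric.isClosed_closedBall
    have : x - y ∈ tsupport (ρ k) := subset_tsupport _ hy
    rw [hρt, Metric.mem_closedBall, dist_eq_norm] at this
    rw [Metric.mem_closedBall, dist_eq_norm, ← norm_neg]
    convert! this using 2
    abel
  have hpd : ∀ k i, ∀ x ∈ Ω, pd i (φ k).1 x = ∫ y, ρ k y • Ω.indicator (g i) (x - y) := by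
    intro k i x hx
    refine pd_mollify hΩ.measurableSet hul (hρd k) (hρs k) ?_
    have hθd : ContDiff ℝ ∞ fun y => ρ k (x - y) := (hρd k).comp (contDiff_const.sub contDiff_id)
    by_cases hxb : x ∈ Metric.ball x₀ r
    · refine hweak i _ ⟨hθd, ?_, (hθs k x).trans (hcone x ⟨hx, hxb⟩ (t k) ⟨ht0 k, ?_⟩)⟩
      · exact HasCompactSupport.of_support_subset_isCompact (isCompact_closedBall _ _)
          ((subset_tsupport _).trans (hθs k x))
      · linarith [htr k]
    · have hdisj : ∀ y ∈ tsupport (fun y => ρ k (x - y)), y ∉ tsupport η := by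
        intro y hy hy'
        have h1 := hθs k x hy
        have h2 := hηs hy'
        rw [Metric.mem_closedBall] at h1
        rw [Metric.mem_ball] at h2
        refine hxb (Metric.mem_ball.mpr ?_)
        have h3 : dist x (x + t k • ν) ≤ t k := by
          rw [dist_self_add_right, norm_smul, Real.norm_of_nonneg (ht0 k).le]
          exact mul_le_of_le_one_right (ht0 k).le hν
        have h4 := mul_le_of_le_one_left (ht0 k).le hκ1
        have h5 := dist_triangle4 x (x + t k • ν) y x₀
        rw [dist_comm (x + t k • ν) y] at h5
        linarith [htr k]
      rw [integral_eq_zero_of_ae, integral_eq_zero_of_ae, neg_zero]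
      · refine .of_forall fun y => ?_
        by_cases hy : y ∈ tsupport (fun y => ρ k (x - y))
        · simp [hg, image_eq_zero_of_notMem_tsupport (hdisj y hy),
            pd_eq_zero_of_notMem_tsupport (hdisj y hy)]
        · have : ρ k (x - y) = 0 :=
            image_eq_zero_of_notMem_tsupport (f := fun y => ρ k (x - y)) hy
          simp [this]
      · refine .of_forall fun y => ?_
        by_cases hy : y ∈ tsupport (fun y => ρ k (x - y))
        · simp [hu, image_eq_zero_of_notMem_tsupport (hdisj y hy)]
        · simp [pd_eq_zero_of_notMem_tsupport hy]
  have hmoll : ∀ {v : E n → Clif n}, StronglyMeasurable (Ω.indicator v) →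
      MemLp (Ω.indicator v) 2 volume → Tendsto (fun k => eLpNorm (fun x =>
        (∫ y, ρ k y • Ω.indicator v (x - y)) - v x) 2 (volume.restrict Ω)) atTop (𝓝 0) := by
    intro v hv hv'
    have h := tendsto_eLpNorm_mollify hv hv' (fun k => (hρd k).continuous) hρs
      (fun k => (f k).nonneg_normed) (fun k => (f k).integral_normed)
      (by simpa using htl.const_mul 2) hρR
    refine tendsto_of_tendsto_of_tendsto_of_le_of_le tendsto_const_nhds h (fun _ => zero_le)
      fun k => ?_
    refine le_trans (le_of_eq (eLpNorm_congr_ae ?_))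
      (eLpNorm_mono_measure _ Measure.restrict_le_self)
    filter_upwards [ae_restrict_mem hΩ.measurableSet] with x hx
    rw [Set.indicator_of_mem hx]
  refine mem_closure_of_tendsto (f := fun k => ofSmooth Ω (φ k)) (b := atTop) ?_
    (.of_forall fun k => ⟨φ k, rfl⟩)
  rw [tendsto_ofSmooth_iff]
  constructor
  · refine (hmoll hus huM).congr fun k => eLpNorm_congr_ae ?_
    filter_upwards [fn_mulH1 hη hηc w] with x hx
    rw [hx]
  · intro i
    refine (hmoll (hgs i) (hgM i)).congr fun k => eLpNorm_congr_ae ?_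
    filter_upwards [der_mulH1 hη hηc w i, ae_restrict_mem hΩ.measurableSet] with x hx hxΩ
    rw [hx, hpd k i x hxΩ]

/-- Products with a suitable cutoff function equal to one on a given compact set are limits of
smooth functions. -/
lemma exists_cutoff_mem_closure (hΩ : IsOpen Ω) (hcone : ∀ x, HasConeAt Ω x) {K : Set (E n)}
    (hK : IsCompact K) :
    ∃ (ψ : E n → ℝ) (hψ : ContDiff ℝ ∞ ψ) (hc : HasCompactSupport ψ), (∀ x ∈ K, ψ x = 1) ∧
      ∀ w : H1 Ω, mulH1 hψ hc w ∈ (LinearMap.range (ofSmooth Ω)).topologicalClosure := by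
  set S := (LinearMap.range (ofSmooth Ω)).topologicalClosure with hS
  refine hK.induction_on (p := fun K => ∃ (ψ : E n → ℝ) (hψ : ContDiff ℝ ∞ ψ)
    (hc : HasCompactSupport ψ), (∀ x ∈ K, ψ x = 1) ∧ ∀ w : H1 Ω, mulH1 hψ hc w ∈ S) ?_ ?_ ?_ ?_
  · refine ⟨fun _ => 0, contDiff_const, HasCompactSupport.zero, by simp, fun w => ?_⟩
    convert! S.zero_mem
    refine H1.ext (Lp.ext ?_) fun i => Lp.ext ?_
    · filter_upwards [fn_mulH1 (Ω := Ω) (ψ := fun _ => 0) contDiff_const HasCompactSupport.zero w,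
        Lp.coeFn_zero (Clif n) 2 (volume.restrict Ω)] with x h1 h2
      rw [h1, zero_smul]; exact h2.symm
    · filter_upwards [der_mulH1 (Ω := Ω) (ψ := fun _ => 0) contDiff_const HasCompactSupport.zero w i,
        Lp.coeFn_zero (Clif n) 2 (volume.restrict Ω)] with x h1 h2
      rw [h1, zero_smul, pd_eq_zero_of_notMem_tsupport (by simp), zero_smul, add_zero]
      exact h2.symm
  · rintro s t hst ⟨ψ, hψ, hc, h1, hm⟩
    exact ⟨ψ, hψ, hc, fun x hx => h1 x (hst hx), hm⟩
  · rintro s t ⟨ψ, hψ, hc, h1, hm⟩ ⟨χ, hχ, hc', h1', hm'⟩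
    have hm2 : HasCompactSupport fun x => ψ x * χ x := hc.mul_right
    refine ⟨fun x => ψ x + χ x + (-1 : ℝ) * (ψ x * χ x),
      (hψ.add hχ).add (contDiff_const.mul (hψ.mul hχ)), (hc.add hc').add hm2.mul_left,
      fun x hx => ?_, fun w => ?_⟩
    · dsimp only
      rcases hx with hx | hx
      · rw [h1 x hx]; ring
      · rw [h1' x hx]; ring
    · have := S.sub_mem (S.add_mem (hm w) (hm' w)) (hm (mulH1 hχ hc' w))
      rw [mulH1_mulH1] at this
      refine (congrArg (· ∈ S) ?_).mpr this
      refine H1.ext (Lp.ext ?_) fun i => Lp.ext ?_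
      · rw [fn_sub, fn_add]
        refine (fn_mulH1 _ _ w).trans ?_
        filter_upwards [fn_mulH1 hψ hc w, fn_mulH1 hχ hc' w, fn_mulH1 (hψ.mul hχ) hm2 w,
          Lp.coeFn_sub (fn (mulH1 hψ hc w) + fn (mulH1 hχ hc' w)) (fn (mulH1 (hψ.mul hχ) hm2 w)),
          Lp.coeFn_add (fn (mulH1 hψ hc w)) (fn (mulH1 hχ hc' w))] with x e1 e2 e3 e4 e5
        rw [e4, Pi.sub_apply, e5, Pi.add_apply, e1, e2, e3]
        module
      · rw [der_sub, der_add]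
        refine (der_mulH1 _ _ w i).trans ?_
        filter_upwards [der_mulH1 hψ hc w i, der_mulH1 hχ hc' w i, der_mulH1 (hψ.mul hχ) hm2 w i,
          Lp.coeFn_sub (der (mulH1 hψ hc w) i + der (mulH1 hχ hc' w) i)
            (der (mulH1 (hψ.mul hχ) hm2 w) i),
          Lp.coeFn_add (der (mulH1 hψ hc w) i) (der (mulH1 hχ hc' w) i)] with x e1 e2 e3 e4 e5
        have hp : pd i (fun x => ψ x + χ x + (-1 : ℝ) * (ψ x * χ x)) x =
            pd i ψ x + pd i χ x + (-1 : ℝ) * pd i (fun x => ψ x * χ x) x := by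
          rw [← pd_add hψ hχ, ← smul_eq_mul, ← pd_const_smul (hψ.mul hχ)]
          exact pd_add (hψ.add hχ) ((hψ.mul hχ).const_smul (-1 : ℝ)) i x
        rw [e4, Pi.sub_apply, e5, Pi.add_apply, e1, e2, e3, hp]
        module
  · intro x _
    obtain ⟨r, κ, ν, hr, hκ, hκ1, hν, h⟩ := hcone x
    let f : ContDiffBump x := ⟨r / 8, r / 4, by positivity, by linarith⟩
    refine ⟨Metric.ball x (r / 8), mem_nhdsWithin_of_mem_nhds (Metric.ball_mem_nhds _ (by positivity)),
      f, f.contDiff, f.hasCompactSupport, fun y hy => f.one_of_mem_closedBall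
        (Metric.ball_subset_closedBall hy), fun w =>
      mulH1_mem_closure_of_cone hΩ hr hκ hκ1 hν h _ _ ?_ w⟩
    rw [f.tsupport_eq]
    exact Metric.closedBall_subset_ball (show r / 4 < r / 2 by linarith)

/-- Multiplication with dilated cutoff functions approximates the identity of `H¹(Ω)`. -/
lemma exists_tendsto_mulH1 (u : H1 Ω) :
    ∃ (χ : ℕ → E n → ℝ) (hχ : ∀ k, ContDiff ℝ ∞ (χ k)) (hc : ∀ k, HasCompactSupport (χ k)),
      Tendsto (fun k => mulH1 (hχ k) (hc k) u) atTop (𝓝 u) := by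
  let f : ContDiffBump (0 : E n) := ⟨1, 2, one_pos, one_lt_two⟩
  set R : ℕ → ℝ := fun k => 1 / ((k : ℝ) + 1) with hR
  have hR0 : ∀ k, 0 < R k := fun k => by positivity
  have hR1 : ∀ k, R k ≤ 1 := fun k => by
    rw [hR]; dsimp only
    rw [div_le_one (by positivity)]
    linarith [(Nat.cast_nonneg k : (0 : ℝ) ≤ k)]
  have hRl : Tendsto R atTop (𝓝 0) := tendsto_one_div_add_atTop_nhds_zero_nat
  set χ : ℕ → E n → ℝ := fun k x => f (R k • x) with hχdef
  have hχ : ∀ k, ContDiff ℝ ∞ (χ k) := fun k => f.contDiff.comp (contDiff_const_smul _)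
  have hc : ∀ k, HasCompactSupport (χ k) := fun k =>
    f.hasCompactSupport.comp_smul (hR0 k).ne'
  have hpd : ∀ k i x, pd i (χ k) x = R k * pd i f (R k • x) := by
    intro k i x
    unfold pd
    rw [hχdef]; dsimp only
    rw [fderiv_comp_smul]; rfl
  refine ⟨χ, hχ, hc, ?_⟩
  have h1 : ∀ v : L2 Ω, Tendsto (fun k => eLpNorm (fun x => (χ k x - 1) • v x) 2
      (volume.restrict Ω)) atTop (𝓝 0) := by
    intro v
    refine tendsto_eLpNorm_smul_zero (Lp.memLp v) (C := 1)
      (fun k => ((hχ k).continuous.sub continuous_const).measurable) (fun k x => ?_) fun x => ?_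
    · rw [abs_le]
      constructor <;> linarith [f.nonneg (x := R k • x), f.le_one (x := R k • x)]
    · have : Tendsto (fun k => R k • x) atTop (𝓝 0) := by simpa using hRl.smul_const x
      have h2 := ((f.contDiff (n := 0)).continuous.tendsto 0).comp this
      rw [f.one_of_mem_closedBall (by simp [f])] at h2
      simpa using h2.sub_const 1
  have h2 : ∀ i, Tendsto (fun k => eLpNorm (fun x => pd i (χ k) x • fn u x) 2
      (volume.restrict Ω)) atTop (𝓝 0) := by
    intro i
    have hfc := continuous_pd_of_contDiff (φ := f) f.contDiff i
    obtain ⟨C, hC⟩ := (hasCompactSupport_pd_of (φ := f) f.hasCompactSupport i).exists_bound_of_continuous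
      hfc
    refine tendsto_eLpNorm_smul_zero (Lp.memLp (fn u)) (C := C)
      (fun k => (continuous_pd_of_contDiff (hχ k) i).measurable) (fun k x => ?_) fun x => ?_
    · rw [hpd, abs_mul, abs_of_pos (hR0 k)]
      exact (mul_le_of_le_one_left (abs_nonneg _) (hR1 k)).trans (hC _)
    · simp_rw [hpd]
      refine squeeze_zero_norm (a := fun k => R k * C) (fun k => ?_) (by simpa using hRl.mul_const C)
      rw [norm_mul, Real.norm_of_nonneg (hR0 k).le]
      gcongr
      exact hC _
  rw [tendsto_H1_iff]
  constructor
  · rw [Lp.tendsto_Lp_iff_tendsto_eLpNorm']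
    refine (h1 (fn u)).congr fun k => eLpNorm_congr_ae ?_
    filter_upwards [fn_mulH1 (hχ k) (hc k) u] with x hx
    rw [Pi.sub_apply, hx, sub_smul, one_smul]
  · intro i
    rw [Lp.tendsto_Lp_iff_tendsto_eLpNorm']
    have h3 := (h1 (der u i)).add (h2 i)
    rw [add_zero] at h3
    refine tendsto_of_tendsto_of_tendsto_of_le_of_le tendsto_const_nhds h3 (fun _ => zero_le)
      fun k => ?_
    refine le_trans (le_of_eq (eLpNorm_congr_ae ?_)) (eLpNorm_add_le
      (((hχ k).continuous.sub continuous_const).aestronglyMeasurable.smul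
        (Lp.aestronglyMeasurable (der u i)))
      ((continuous_pd_of_contDiff (hχ k) i).aestronglyMeasurable.smul
        (Lp.aestronglyMeasurable (fn u))) (by norm_num))
    filter_upwards [der_mulH1 (hχ k) (hc k) u i] with x hx
    simp only [Pi.sub_apply, Pi.add_apply, hx]
    module

/-- Smooth functions are dense in `H¹(Ω)`. -/
theorem denseRange_ofSmooth (hΩ : IsMinimallySmooth Ω) : DenseRange (ofSmooth Ω) := by
  intro u
  obtain ⟨χ, hχ, hc, hlim⟩ := exists_tendsto_mulH1 u
  refine (LinearMap.range (ofSmooth Ω)).isClosed_topologicalClosure.mem_of_tendsto hlim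
    (.of_forall fun k => ?_)
  obtain ⟨ψ, hψ, hψc, h1, hmem⟩ := exists_cutoff_mem_closure hΩ.1 hΩ.hasConeAt (hc k)
  have h := hmem (mulH1 (hχ k) (hc k) u)
  rw [mulH1_mulH1] at h
  have e : (fun x => ψ x * χ k x) = χ k := by
    ext x
    by_cases hx : x ∈ tsupport (χ k)
    · rw [h1 x hx, one_mul]
    · rw [image_eq_zero_of_notMem_tsupport hx, mul_zero]
  simp only [e] at h
  exact h

end Density

/-! ### The trace operator -/

section Trace

variable {n : ℕ} {Ω : Set (E n)}

lemma lintegral_sobDensity (φ : Smooth n) :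
    ∫⁻ x in Ω, sobDensity φ.1 x = ENNReal.ofReal (‖ofSmooth Ω φ‖ ^ 2) := by
  have hm : ∀ i, Measurable fun x => ‖pd i φ.1 x‖ₑ ^ 2 := fun i =>
    (continuous_pd_of_contDiff φ.2.1 i).enorm.measurable.pow_const 2
  unfold sobDensity
  rw [lintegral_add_right _ (Finset.measurable_fun_sum _ fun i _ => hm i),
    lintegral_finsetSum _ fun i _ => hm i, norm_sq_H1,
    ENNReal.ofReal_add (by positivity) (by positivity),
    ENNReal.ofReal_sum_of_nonneg fun i _ => by positivity]
  simp_rw [← eLpNorm_two_sq, ENNReal.ofReal_pow (norm_nonneg _), ofReal_norm, fn_ofSmooth,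
    der_ofSmooth, Lp.enorm_def]
  rw [eLpNorm_congr_ae (MemLp.coeFn_toLp _)]
  congr 1
  exact Finset.sum_congr rfl fun i _ => by rw [eLpNorm_congr_ae (MemLp.coeFn_toLp _)]

lemma exists_eLpNorm_surf_le (hn : 0 < n) (hΩ : IsMinimallySmooth Ω) :
    ∃ C : ℝ≥0, ∀ φ : Smooth n,
      eLpNorm φ.1 2 (surf Ω) ≤ ENNReal.ofReal (C * ‖ofSmooth Ω φ‖) := by
  obtain ⟨C, hC⟩ := exists_trace_inequality hn hΩ
  refine ⟨NNReal.sqrt C, fun φ => ?_⟩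
  have h := hC φ.1 φ.2.1
  rw [← eLpNorm_two_sq, lintegral_sobDensity] at h
  refine (ENNReal.pow_le_pow_left_iff two_ne_zero).mp (h.trans_eq ?_)
  rw [← ENNReal.ofReal_pow (by positivity), mul_pow, ENNReal.ofReal_mul (by positivity)]
  congr 1
  rw [← NNReal.coe_pow, NNReal.sq_sqrt, ENNReal.ofReal_coe_nnreal]

lemma memLp_surf (hn : 0 < n) (hΩ : IsMinimallySmooth Ω) (φ : Smooth n) :
    MemLp φ.1 2 (surf Ω) := by
  obtain ⟨C, hC⟩ := exists_eLpNorm_surf_le hn hΩ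
  exact ⟨φ.2.1.continuous.aestronglyMeasurable, (hC φ).trans_lt ENNReal.ofReal_lt_top⟩

/-- The restriction to `∂Ω` of smooth functions. -/
def bdOf (hn : 0 < n) (hΩ : IsMinimallySmooth Ω) : Smooth n →ₗ[ℝ] L2bd Ω where
  toFun φ := (memLp_surf hn hΩ φ).toLp φ.1
  map_add' _ _ := rfl
  map_smul' _ _ := rfl

lemma exists_norm_bdOf_le (hn : 0 < n) (hΩ : IsMinimallySmooth Ω) :
    ∃ C : ℝ, ∀ φ, ‖bdOf hn hΩ φ‖ ≤ C * ‖ofSmooth Ω φ‖ := by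
  obtain ⟨C, hC⟩ := exists_eLpNorm_surf_le hn hΩ
  refine ⟨C, fun φ => ?_⟩
  change ‖(memLp_surf hn hΩ φ).toLp φ.1‖ ≤ _
  rw [Lp.norm_toLp]
  exact ENNReal.toReal_le_of_le_ofReal (by positivity) (hC φ)

/-- The Dirichlet trace as a continuous linear map. -/
def traceL (hn : 0 < n) (hΩ : IsMinimallySmooth Ω) : H1 Ω →L[ℝ] L2bd Ω :=
  (bdOf hn hΩ).extendOfNorm (ofSmooth Ω)

lemma traceL_ofSmooth (hn : 0 < n) (hΩ : IsMinimallySmooth Ω) (φ : Smooth n) :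
    traceL hn hΩ (ofSmooth Ω φ) = bdOf hn hΩ φ :=
  LinearMap.extendOfNorm_eq (denseRange_ofSmooth hΩ) (exists_norm_bdOf_le hn hΩ) φ

lemma isTrace_iff (hn : 0 < n) (hΩ : IsMinimallySmooth Ω) {u : H1 Ω} {g : L2bd Ω} :
    IsTrace u g ↔ ∃ φ : ℕ → Smooth n, Tendsto (fun k => ofSmooth Ω (φ k)) atTop (𝓝 u) ∧
      Tendsto (fun k => bdOf hn hΩ (φ k)) atTop (𝓝 g) := by
  have hbd : ∀ φ : ℕ → Smooth n, Tendsto (fun k => bdOf hn hΩ (φ k)) atTop (𝓝 g) ↔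
      Tendsto (fun k => eLpNorm (fun x => (φ k).1 x - g x) 2 (surf Ω)) atTop (𝓝 0) := by
    intro φ
    rw [Lp.tendsto_Lp_iff_tendsto_eLpNorm']
    refine tendsto_congr fun k => eLpNorm_congr_ae ?_
    filter_upwards [(memLp_surf hn hΩ (φ k)).coeFn_toLp] with x hx
    rw [Pi.sub_apply]
    congr 1
  constructor
  · rintro ⟨φ, hφ, h1, h2, h3⟩
    exact ⟨fun k => ⟨φ k, hφ k⟩, tendsto_ofSmooth_iff.mpr ⟨h1, h2⟩, (hbd _).mpr h3⟩
  · rintro ⟨φ, h1, h2⟩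
    obtain ⟨h1, h1'⟩ := tendsto_ofSmooth_iff.mp h1
    exact ⟨fun k => (φ k).1, fun k => (φ k).2, h1, h1', (hbd φ).mp h2⟩

lemma isTrace_iff_eq (hn : 0 < n) (hΩ : IsMinimallySmooth Ω) {u : H1 Ω} {g : L2bd Ω} :
    IsTrace u g ↔ g = traceL hn hΩ u := by
  rw [isTrace_iff hn hΩ]
  constructor
  · rintro ⟨φ, h1, h2⟩
    have h3 := ((traceL hn hΩ).continuous.tendsto u).comp h1
    refine tendsto_nhds_unique h2 (h3.congr fun k => ?_)
    exact traceL_ofSmooth hn hΩ (φ k)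
  · rintro rfl
    obtain ⟨v, hv, hlim⟩ := mem_closure_iff_seq_limit.mp (denseRange_ofSmooth hΩ u)
    choose φ hφ using hv
    have h : Tendsto (fun k => ofSmooth Ω (φ k)) atTop (𝓝 u) := by simpa only [hφ] using hlim
    refine ⟨φ, h, ?_⟩
    refine (((traceL hn hΩ).continuous.tendsto u).comp h).congr fun k => ?_
    exact traceL_ofSmooth hn hΩ (φ k)

lemma trace_eq_traceL (hn : 0 < n) (hΩ : IsMinimallySmooth Ω) (u : H1 Ω) :
    trace u = traceL hn hΩ u := by
  have h : ∃ g, IsTrace u g := ⟨_, (isTrace_iff_eq hn hΩ).mpr rfl⟩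
  rw [trace, dif_pos h]
  exact (isTrace_iff_eq hn hΩ).mp h.choose_spec

/-! ### Post-composition with linear maps -/

lemma IsWeakDeriv.comp {i : Fin n} {u g : L2 Ω} (h : IsWeakDeriv Ω i u g)
    (L : Clif n →L[ℝ] Clif n) : IsWeakDeriv Ω i (L.compLp u) (L.compLp g) := by
  have h' : IsWeakDeriv Ω i (fun x => L (u x)) (fun x => L (g x)) := by
    intro φ hφ
    simp_rw [← map_smul]
    rw [L.integral_comp_comm (integrable_pd_smul hφ i u),
      L.integral_comp_comm (integrable_smul_L2 hφ.1.continuous hφ.2.1 g), h φ hφ, map_neg]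
  exact h'.congr (L.coeFn_compLp' u).symm (L.coeFn_compLp' g).symm

/-- Post-composition of an element of `H¹(Ω)` with a linear map of `ℝ_n`. -/
def mapH1 (L : Clif n →L[ℝ] Clif n) (u : H1 Ω) : H1 Ω :=
  ⟨WithLp.toLp 2 (L.compLp (fn u), WithLp.toLp 2 fun i => L.compLp (der u i)),
    fun i => (isWeakDeriv_der u i).comp L⟩

lemma fn_mapH1 (L : Clif n →L[ℝ] Clif n) (u : H1 Ω) : fn (mapH1 L u) = L.compLp (fn u) := rfl

lemma der_mapH1 (L : Clif n →L[ℝ] Clif n) (u : H1 Ω) (i : Fin n) :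
    der (mapH1 L u) i = L.compLp (der u i) := rfl

lemma continuous_mapH1 (L : Clif n →L[ℝ] Clif n) :
    Continuous (mapH1 L : H1 Ω → H1 Ω) := by
  refine continuous_iff_continuousAt.mpr fun u => ?_
  have hL : Continuous fun v : L2 Ω => L.compLp v :=
    LipschitzWith.continuous_compLp L.lipschitz (map_zero L)
  exact tendsto_H1_iff.mpr ⟨(hL.comp (fnL Ω).continuous).tendsto u,
    fun i => (hL.comp (derL Ω i).continuous).tendsto u⟩

/-- Post-composition of a smooth function with a linear map of `ℝ_n`. -/
def mapSmooth (L : Clif n →L[ℝ] Clif n) (φ : Smooth n) : Smooth n :=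
  ⟨fun x => L (φ.1 x), L.contDiff.comp φ.2.1, φ.2.2.comp_left (map_zero L)⟩

lemma mapH1_ofSmooth (L : Clif n →L[ℝ] Clif n) (φ : Smooth n) :
    mapH1 L (ofSmooth Ω φ) = ofSmooth Ω (mapSmooth L φ) := by
  refine H1.ext (Lp.ext ?_) fun i => Lp.ext ?_
  · rw [fn_mapH1, fn_ofSmooth, fn_ofSmooth]
    filter_upwards [L.coeFn_compLp ((Smooth.memLp φ (volume.restrict Ω)).toLp φ.1),
      (Smooth.memLp φ (volume.restrict Ω)).coeFn_toLp,
      (Smooth.memLp (mapSmooth L φ) (volume.restrict Ω)).coeFn_toLp] with x h1 h2 h3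
    rw [h1, h2, h3]; rfl
  · rw [der_mapH1, der_ofSmooth, der_ofSmooth]
    filter_upwards [L.coeFn_compLp ((Smooth.memLp_pd φ i (volume.restrict Ω)).toLp (pd i φ.1)),
      (Smooth.memLp_pd φ i (volume.restrict Ω)).coeFn_toLp,
      (Smooth.memLp_pd (mapSmooth L φ) i (volume.restrict Ω)).coeFn_toLp] with x h1 h2 h3
    rw [h1, h2, h3]
    have h4 : HasFDerivAt (mapSmooth L φ).1 _ x :=
      L.hasFDerivAt.comp x (φ.2.1.differentiable (by simp) x).hasFDerivAt
    unfold pd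
    rw [h4.fderiv]; rfl

lemma traceL_mapH1 (hn : 0 < n) (hΩ : IsMinimallySmooth Ω) (L : Clif n →L[ℝ] Clif n) (u : H1 Ω) :
    traceL hn hΩ (mapH1 L u) = L.compLp (traceL hn hΩ u) := by
  have hL : Continuous fun v : L2bd Ω => L.compLp v :=
    LipschitzWith.continuous_compLp L.lipschitz (map_zero L)
  refine congrFun ((denseRange_ofSmooth hΩ).equalizer
    ((traceL hn hΩ).continuous.comp (continuous_mapH1 L))
    (hL.comp (traceL hn hΩ).continuous) (funext fun φ => Lp.ext ?_)) u
  simp only [Function.comp_apply]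
  rw [mapH1_ofSmooth, traceL_ofSmooth, traceL_ofSmooth]
  filter_upwards [L.coeFn_compLp (bdOf hn hΩ φ), (memLp_surf hn hΩ φ).coeFn_toLp,
    (memLp_surf hn hΩ (mapSmooth L φ)).coeFn_toLp] with x h1 h2 h3
  rw [h1]
  refine h3.trans ?_
  change L (φ.1 x) = L ((memLp_surf hn hΩ φ).toLp φ.1 x)
  rw [h2]

end Trace

/-! ### The Clifford-valued inner product -/

section CliffordInner

variable {n : ℕ}

lemma csign_mul_self (A B : Finset (Fin n)) : csign A B * csign A B = 1 := by
  unfold csign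
  simp_rw [← Finset.prod_mul_distrib]
  exact Finset.prod_eq_one fun a _ => Finset.prod_eq_one fun b _ => by split_ifs <;> norm_num

lemma csign_sq (A B : Finset (Fin n)) : csign A B ^ 2 = 1 := by
  rw [pow_two, csign_mul_self]

lemma cmul_bv_left_apply (A C : Finset (Fin n)) (x : Clif n) :
    cmul (bv A) x (symmDiff A C) = csign A C * x C := by
  have h : cmul (bv A) x = ∑ B, x B • (csign A B • bv (symmDiff A B)) := by
    change cmulL n (bv A) x = _
    conv_lhs => rw [← sum_bv x]
    simp only [map_sum, map_smul]
    exact Finset.sum_congr rfl fun B _ => by rw [← cmul_bv]; rfl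
  rw [h, WithLp.ofLp_sum, Finset.sum_apply, Finset.sum_eq_single C]
  · simp [bv_apply, mul_comm]
  · intro B _ hB
    have : symmDiff A C ≠ symmDiff A B := fun h => hB (symmDiff_right_injective A h).symm
    simp [bv_apply, this]
  · simp

lemma norm_cmul_bv_left (A : Finset (Fin n)) (x : Clif n) : ‖cmul (bv A) x‖ = ‖x‖ := by
  rw [← sq_eq_sq₀ (norm_nonneg _) (norm_nonneg _), EuclideanSpace.norm_sq_eq,
    EuclideanSpace.norm_sq_eq]
  rw [← Equiv.sum_comp (symmDiff_left_involutive A).toPerm]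
  refine Finset.sum_congr rfl fun C _ => ?_
  change ‖cmul (bv A) x (symmDiff C A)‖ ^ 2 = _
  rw [symmDiff_comm, cmul_bv_left_apply, norm_mul, mul_pow, Real.norm_eq_abs, sq_abs, csign_sq,
    one_mul]

/-- Left multiplication as a continuous linear map. -/
def lmulL (y : Clif n) : Clif n →L[ℝ] Clif n := (cmulL n y).toContinuousLinearMap

/-- Right multiplication as a continuous linear map. -/
def rmulL (y : Clif n) : Clif n →L[ℝ] Clif n := ((cmulL n).flip y).toContinuousLinearMap

@[simp] lemma lmulL_apply (y x : Clif n) : lmulL y x = cmul y x := rfl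

@[simp] lemma rmulL_apply (y x : Clif n) : rmulL y x = cmul x y := rfl

lemma norm_lmulL_bv_le (A : Finset (Fin n)) : ‖lmulL (bv A)‖ ≤ 1 :=
  ContinuousLinearMap.opNorm_le_bound _ zero_le_one fun x => by
    rw [lmulL_apply, norm_cmul_bv_left, one_mul]

lemma sc_cmul_conj_bv (A B : Finset (Fin n)) :
    sc (cmul (conj (bv A)) (bv B)) = if A = B then 1 else 0 := by
  rw [conj_bv, cmul_smul_left, cmul_bv, smul_smul, sc, PiLp.smul_apply, bv_apply]
  by_cases h : A = B
  · subst h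
    simp [csign_mul_self]
  · have : ∅ ≠ symmDiff A B := fun h' => h (symmDiff_eq_bot.mp h'.symm)
    simp [h, this]

lemma eq_zero_of_sc_cmul {x : Clif n} (h : ∀ C, sc (cmul x (bv C)) = 0) : x = 0 := by
  ext C
  have h1 := h C
  have h2 : cmul x (bv C) = ∑ A, x A • (csign A C • bv (symmDiff A C)) := by
    change (cmulL n).flip (bv C) x = _
    conv_lhs => rw [← sum_bv x]
    simp only [map_sum, map_smul]
    exact Finset.sum_congr rfl fun B _ => by rw [← cmul_bv]; rfl
  rw [h2, sc, WithLp.ofLp_sum, Finset.sum_apply, Finset.sum_eq_single C] at h1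
  · have h3 : x C * csign C C = 0 := by simpa [bv_apply] using h1
    rcases mul_eq_zero.mp h3 with h4 | h4
    · exact h4
    · have := csign_mul_self C C
      rw [h4] at this
      norm_num at this
  · intro A _ hA
    have : ∅ ≠ symmDiff A C := fun h' => hA (symmDiff_eq_bot.mp h'.symm)
    simp [bv_apply, this]
  · simp

variable {μ : Measure (E n)}

lemma cinner_congr {f f' g g' : E n → Clif n} (hf : f =ᵐ[μ] f') (hg : g =ᵐ[μ] g') :
    cinner μ f g = cinner μ f' g' := by
  unfold cinner
  refine Finset.sum_congr rfl fun A _ => Finset.sum_congr rfl fun B _ => ?_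
  congr 1
  refine integral_congr_ae ?_
  filter_upwards [hf, hg] with x h1 h2
  rw [h1, h2]

lemma integrable_coord_mul {f g : E n → Clif n} (hf : MemLp f 2 μ) (hg : MemLp g 2 μ)
    (A B : Finset (Fin n)) : Integrable (fun x => f x A * g x B) μ :=
  MemLp.integrable_mul (p := 2) (q := 2)
    ((EuclideanSpace.proj A : Clif n →L[ℝ] ℝ).comp_memLp' hf)
    ((EuclideanSpace.proj B : Clif n →L[ℝ] ℝ).comp_memLp' hg)

/-- The scalar part of the Clifford-valued inner product is the `L²` inner product. -/
lemma sc_cinner (f g : Lp (Clif n) 2 μ) : sc (cinner μ f g) = inner ℝ f g := by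
  have h1 : sc (cinner μ f g) = ∑ A, ∫ x, f x A * g x A ∂μ := by
    have : ∀ A B, sc ((∫ x, f x A * g x B ∂μ) • cmul (conj (bv A)) (bv B)) =
        if A = B then ∫ x, f x A * g x B ∂μ else 0 := by
      intro A B
      have := sc_cmul_conj_bv A B
      unfold sc at this ⊢
      rw [PiLp.smul_apply, this, smul_eq_mul]; split_ifs <;> simp
    unfold sc at this ⊢
    unfold cinner
    simp only [WithLp.ofLp_sum, Finset.sum_apply, this, Finset.sum_ite_eq, Finset.mem_univ, if_true]
  rw [h1, ← integral_finsetSum _ fun A _ => integrable_coord_mul (Lp.memLp f) (Lp.memLp g) A A,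
    L2.inner_def]
  refine integral_congr_ae (.of_forall fun x => ?_)
  simp [PiLp.inner_apply, mul_comm]

lemma cinner_eq_integral {f g : E n → Clif n} (hf : MemLp f 2 μ) (hg : MemLp g 2 μ) :
    Integrable (fun x => cmul (conj (f x)) (g x)) μ ∧
      cinner μ f g = ∫ x, cmul (conj (f x)) (g x) ∂μ := by
  have e : ∀ x y : Clif n, cmul (conj x) y =
      ∑ A, ∑ B, (x A * y B) • cmul (conj (bv A)) (bv B) := by
    intro x y
    have hx : conj x = ∑ A, x A • conj (bv A) := by
      simp_rw [conj_bv, csign_self, smul_smul, conj, mul_comm (x _)]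
    rw [hx]
    change cmulL n _ y = ∑ A, ∑ B, (x A * y B) • cmulL n (conj (bv A)) (bv B)
    conv_lhs => rw [← sum_bv y]
    simp only [map_sum, map_smul, LinearMap.sum_apply, LinearMap.smul_apply, Finset.smul_sum,
      smul_smul]
    rw [Finset.sum_comm]
    exact Finset.sum_congr rfl fun A _ => Finset.sum_congr rfl fun B _ => by rw [mul_comm]
  have hi : ∀ A B, Integrable (fun x => (f x A * g x B) • cmul (conj (bv A)) (bv B)) μ :=
    fun A B => (integrable_coord_mul hf hg A B).smul_const _
  rw [show (fun x => cmul (conj (f x)) (g x)) = fun x => ∑ A, ∑ B,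
    (f x A * g x B) • cmul (conj (bv A)) (bv B) from funext fun x => e _ _]
  refine ⟨integrable_finsetSum _ fun A _ => integrable_finsetSum _ fun B _ => hi A B, ?_⟩
  rw [integral_finsetSum _ fun A _ => integrable_finsetSum _ fun B _ => hi A B]
  refine Finset.sum_congr rfl fun A _ => ?_
  rw [integral_finsetSum _ fun B _ => hi A B]
  exact Finset.sum_congr rfl fun B _ => (integral_smul_const _ _).symm

lemma cmul_cinner {f g : E n → Clif n} (hf : MemLp f 2 μ) (hg : MemLp g 2 μ) (y : Clif n) :
    cmul (cinner μ f g) y = cinner μ f fun x => cmul (g x) y := by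
  obtain ⟨h1, h2⟩ := cinner_eq_integral hf hg
  have hg' : MemLp (fun x => cmul (g x) y) 2 μ := (rmulL y).comp_memLp' hg
  rw [h2, (cinner_eq_integral hf hg').2]
  change rmulL y _ = _
  rw [← ContinuousLinearMap.integral_comp_comm _ h1]
  simp only [rmulL_apply, cmul_assoc]

end CliffordInner

/-! ### The Robin form -/

section RobinForm

variable {n : ℕ} {Ω : Set (E n)}

lemma Bcoef_const (a : Fin n → ℝ) (i : Fin n) (x : E n) : Bcoef (fun i _ => a i) i x = 0 := by
  simp [Bcoef, pd]

/-- The second argument of the `i`-th term of the Robin form, for constant coefficients. -/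
def fluxL (Ω : Set (E n)) (a : Fin n → ℝ) (σ : ℝ) (i : Fin n) : H1 Ω →L[ℝ] L2 Ω :=
  a i ^ 2 • derL Ω i + (2 * σ * a i) • ((lmulL (bv {i})).compLpL 2 _).comp (fnL Ω)

lemma fluxL_coeFn (a : Fin n → ℝ) (σ : ℝ) (i : Fin n) (v : H1 Ω) :
    fluxL Ω a σ i v =ᵐ[volume.restrict Ω] fun x => a i ^ 2 • der v i x +
      cmul ((2 * σ * a i) • bv ∅ - Bcoef (fun i _ => a i) i x) (cmul (bv {i}) (fn v x)) := by
  have e : fluxL Ω a σ i v = a i ^ 2 • der v i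
      + (2 * σ * a i) • (lmulL (bv {i})).compLp (fn v) := rfl
  rw [e]
  filter_upwards [Lp.coeFn_add (a i ^ 2 • der v i)
      ((2 * σ * a i) • (lmulL (bv {i})).compLp (fn v)), Lp.coeFn_smul (a i ^ 2) (der v i),
    Lp.coeFn_smul (2 * σ * a i) ((lmulL (bv {i})).compLp (fn v)),
    (lmulL (bv {i})).coeFn_compLp (fn v)] with x h1 h2 h3 h4
  rw [h1, Pi.add_apply, h2, h3, Pi.smul_apply, Pi.smul_apply, h4, Bcoef_const, sub_zero,
    cmul_smul_left, one_cmul, lmulL_apply]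

/-- Multiplication by a bounded function on `L²(∂Ω)`. -/
def bmulL {b : E n → ℝ} (hb : MemLp b ∞ (surf Ω)) : L2bd Ω →L[ℝ] L2bd Ω :=
  (ContinuousLinearMap.lsmul ℝ ℝ (E := Clif n)).holderL (surf Ω) ∞ 2 2 (hb.toLp b)

lemma bmulL_coeFn {b : E n → ℝ} (hb : MemLp b ∞ (surf Ω)) (g : L2bd Ω) :
    bmulL hb g =ᵐ[surf Ω] fun x => b x • g x := by
  have h := (ContinuousLinearMap.lsmul ℝ ℝ (E := Clif n)).coeFn_holder (r := 2) (hb.toLp b) g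
  filter_upwards [hb.coeFn_toLp, h] with x h1 h2
  refine h2.trans ?_
  rw [h1]; rfl

lemma inner_bmulL_self_nonneg {b : E n → ℝ} (hb : MemLp b ∞ (surf Ω))
    (hb0 : ∀ᵐ x ∂(surf Ω), 0 ≤ b x) (g : L2bd Ω) : 0 ≤ inner ℝ (bmulL hb g) g := by
  rw [L2.inner_def]
  refine integral_nonneg_of_ae ?_
  filter_upwards [bmulL_coeFn hb g, hb0] with x h1 h2
  rw [h1, real_inner_smul_left]
  exact mul_nonneg h2 real_inner_self_nonneg

variable (hn : 0 < n) (hΩ : IsMinimallySmooth Ω) (a : Fin n → ℝ) {b : E n → ℝ}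
  (hb : MemLp b ∞ (surf Ω)) (s : Clif n)

/-- The scalar part of the Robin form. -/
def scalarForm : H1 Ω →L[ℝ] H1 Ω →L[ℝ] ℝ :=
  (∑ i, (innerSL ℝ).bilinearComp (derL Ω i) (fluxL Ω a (sc s) i))
    + ‖s‖ ^ 2 • (innerSL ℝ).bilinearComp (fnL Ω) (fnL Ω)
    + (innerSL ℝ).bilinearComp ((bmulL hb).comp (traceL hn hΩ)) (traceL hn hΩ)

lemma scalarForm_apply (u v : H1 Ω) : scalarForm hn hΩ a hb s u v =
    (∑ i, inner ℝ (der u i) (fluxL Ω a (sc s) i v)) + ‖s‖ ^ 2 * inner ℝ (fn u) (fn v)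
      + inner ℝ (bmulL hb (traceL hn hΩ u)) (traceL hn hΩ v) := by
  simp [scalarForm]

lemma robinForm_eq (u v : H1 Ω) : robinForm (fun i _ => a i) b s u v =
    (∑ i, cinner (volume.restrict Ω) (der u i) (fluxL Ω a (sc s) i v))
      + ‖s‖ ^ 2 • cinner (volume.restrict Ω) (fn u) (fn v)
      + cinner (surf Ω) (bmulL hb (traceL hn hΩ u)) (traceL hn hΩ v) := by
  unfold robinForm
  rw [trace_eq_traceL hn hΩ, trace_eq_traceL hn hΩ]
  congr 1
  · congr 1
    exact Finset.sum_congr rfl fun i _ => cinner_congr .rfl (fluxL_coeFn a (sc s) i v).symm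
  · exact cinner_congr (bmulL_coeFn hb _).symm .rfl

lemma sc_robinForm (u v : H1 Ω) :
    sc (robinForm (fun i _ => a i) b s u v) = scalarForm hn hΩ a hb s u v := by
  rw [robinForm_eq hn hΩ a hb, scalarForm_apply]
  simp_rw [← sc_cinner]
  simp [sc]

lemma fluxL_mapH1 (σ : ℝ) (i : Fin n) (y : Clif n) (v : H1 Ω) :
    fluxL Ω a σ i (mapH1 (rmulL y) v) =ᵐ[volume.restrict Ω]
      fun x => cmul (fluxL Ω a σ i v x) y := by
  filter_upwards [fluxL_coeFn a σ i v, fluxL_coeFn a σ i (mapH1 (rmulL y) v),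
    (rmulL y).coeFn_compLp (fn v), (rmulL y).coeFn_compLp (der v i)] with x h1 h2 h3 h4
  rw [h1, h2, fn_mapH1, der_mapH1, h3, h4, cmul_add_left, cmul_smul_left, rmulL_apply, rmulL_apply,
    cmul_assoc, cmul_assoc]

include hn hΩ hb in
lemma robinForm_mapH1 (u v : H1 Ω) (y : Clif n) :
    robinForm (fun i _ => a i) b s u (mapH1 (rmulL y) v) =
      cmul (robinForm (fun i _ => a i) b s u v) y := by
  rw [robinForm_eq hn hΩ a hb, robinForm_eq hn hΩ a hb, cmul_add_left, cmul_add_left,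
    cmul_smul_left]
  have h1 : cmul (∑ i, cinner (volume.restrict Ω) (der u i) (fluxL Ω a (sc s) i v)) y =
      ∑ i, cmul (cinner (volume.restrict Ω) (der u i) (fluxL Ω a (sc s) i v)) y :=
    map_sum ((cmulL n).flip y) _ _
  rw [h1, cmul_cinner (Lp.memLp _) (Lp.memLp _), cmul_cinner (Lp.memLp _) (Lp.memLp _)]
  congr 1
  · congr 1
    · refine Finset.sum_congr rfl fun i _ => ?_
      rw [cmul_cinner (Lp.memLp _) (Lp.memLp _)]
      exact cinner_congr .rfl (fluxL_mapH1 a (sc s) i y v)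
    · congr 1
      exact cinner_congr .rfl ((rmulL y).coeFn_compLp' _)
  · rw [traceL_mapH1]
    exact cinner_congr .rfl ((rmulL y).coeFn_compLp' _)

/-- The Clifford-valued weak equation is equivalent to its scalar part. -/
lemma isRobinSolution_iff (f : L2 Ω) (u : H1 Ω) :
    IsRobinSolution (fun i _ => a i) b s f u ↔
      ∀ v, scalarForm hn hΩ a hb s u v = inner ℝ f (fn v) := by
  constructor
  · intro h v
    rw [← sc_robinForm, h v, sc_cinner]
  · intro h v
    rw [← sub_eq_zero]
    refine eq_zero_of_sc_cmul fun C => ?_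
    have e : cmul (cinner (volume.restrict Ω) f (fn v)) (bv C) =
        cinner (volume.restrict Ω) f (fn (mapH1 (rmulL (bv C)) v)) := by
      rw [cmul_cinner (Lp.memLp _) (Lp.memLp _)]
      exact cinner_congr .rfl ((rmulL (bv C)).coeFn_compLp' _).symm
    have e2 : cmul (robinForm (fun i _ => a i) b s u v - cinner (volume.restrict Ω) f (fn v)) (bv C)
        = cmul (robinForm (fun i _ => a i) b s u v) (bv C)
          - cmul (cinner (volume.restrict Ω) f (fn v)) (bv C) :=
      map_sub ((cmulL n).flip (bv C)) _ _
    have h' := h (mapH1 (rmulL (bv C)) v)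
    rw [← sc_robinForm, ← sc_cinner] at h'
    rw [e2, e, ← robinForm_mapH1 hn hΩ a hb, sc, PiLp.sub_apply]
    exact sub_eq_zero.mpr h'

/-! ### Coercivity -/

lemma seminormD_sq (u : H1 Ω) : seminormD u ^ 2 = ∑ i, ‖der u i‖ ^ 2 :=
  Real.sq_sqrt (Finset.sum_nonneg fun _ _ => by positivity)

lemma upperBound_sq : upperBound a ^ 2 = ∑ i, a i ^ 2 :=
  Real.sq_sqrt (Finset.sum_nonneg fun _ _ => by positivity)

lemma lowerBound_le (i : Fin n) : lowerBound a ≤ a i :=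
  ciInf_le (Set.finite_range a).bddBelow i

include hn in
lemma lowerBound_pos (ha : ∀ i, 0 < a i) : 0 < lowerBound a := by
  have : Nonempty (Fin n) := ⟨⟨0, hn⟩⟩
  obtain ⟨i, hi⟩ := exists_eq_ciInf_of_finite (f := a)
  rw [lowerBound, ← hi]
  exact ha i

/-- The lower bound of the quadratic form by a quadratic polynomial in the two seminorms. -/
lemma le_scalarForm_self (ha : ∀ i, 0 < a i) (hb0 : ∀ᵐ x ∂(surf Ω), 0 ≤ b x) (u : H1 Ω) :
    lowerBound a ^ 2 * seminormD u ^ 2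
      - 2 * |sc s| * upperBound a * seminormD u * ‖fn u‖ + ‖s‖ ^ 2 * ‖fn u‖ ^ 2 ≤
      scalarForm hn hΩ a hb s u u := by
  rw [scalarForm_apply, real_inner_self_eq_norm_sq]
  have h1 := inner_bmulL_self_nonneg hb hb0 (traceL hn hΩ u)
  have hm := lowerBound_pos hn a ha
  have h2 : ∀ i, a i ^ 2 * ‖der u i‖ ^ 2 - 2 * |sc s| * (a i * ‖der u i‖) * ‖fn u‖ ≤
      inner ℝ (der u i) (fluxL Ω a (sc s) i u) := by
    intro i
    have e : fluxL Ω a (sc s) i u = a i ^ 2 • der u i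
      + (2 * sc s * a i) • (lmulL (bv {i})).compLp (fn u) := rfl
    rw [e, inner_add_right, real_inner_smul_right, real_inner_smul_right,
      real_inner_self_eq_norm_sq]
    have h3 : |inner ℝ (der u i) ((lmulL (bv {i})).compLp (fn u))| ≤ ‖der u i‖ * ‖fn u‖ := by
      refine (abs_real_inner_le_norm _ _).trans ?_
      gcongr
      refine (ContinuousLinearMap.norm_compLp_le _ _).trans ?_
      exact mul_le_of_le_one_left (norm_nonneg _) (norm_lmulL_bv_le _)
    have h4 : |2 * sc s * a i * inner ℝ (der u i) ((lmulL (bv {i})).compLp (fn u))| ≤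
        2 * |sc s| * a i * (‖der u i‖ * ‖fn u‖) := by
      rw [abs_mul, abs_mul, abs_mul, abs_two, abs_of_pos (ha i)]
      have := ha i
      gcongr
    have := (abs_le.mp h4).1
    linarith
  have h3 := Finset.sum_le_sum fun i (_ : i ∈ Finset.univ) => h2 i
  rw [Finset.sum_sub_distrib, ← Finset.sum_mul, ← Finset.mul_sum] at h3
  have h4 : lowerBound a ^ 2 * seminormD u ^ 2 ≤ ∑ i, a i ^ 2 * ‖der u i‖ ^ 2 := by
    rw [seminormD_sq, Finset.mul_sum]
    refine Finset.sum_le_sum fun i _ => ?_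
    gcongr
    exact lowerBound_le a i
  have h5 : ∑ i, a i * ‖der u i‖ ≤ upperBound a * seminormD u := by
    refine le_of_sq_le_sq ?_ (mul_nonneg (Real.sqrt_nonneg _) (Real.sqrt_nonneg _))
    rw [mul_pow, upperBound_sq, seminormD_sq]
    exact Finset.sum_mul_sq_le_sq_mul_sq _ _ _
  have h6 : 2 * |sc s| * (∑ i, a i * ‖der u i‖) * ‖fn u‖ ≤
      2 * |sc s| * (upperBound a * seminormD u) * ‖fn u‖ := by gcongr
  linarith

/-- The constant `|s|² - M_a² s₀² / m_a²`. -/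
def gap : ℝ := ‖s‖ ^ 2 - upperBound a ^ 2 * sc s ^ 2 / lowerBound a ^ 2

include hn in
lemma gap_pos (ha : ∀ i, 0 < a i) (hsa : upperBound a / lowerBound a * |sc s| < ‖s‖) :
    0 < gap a s := by
  have hm := lowerBound_pos hn a ha
  have hM : 0 ≤ upperBound a := Real.sqrt_nonneg _
  have h := pow_lt_pow_left₀ hsa (by positivity) two_ne_zero
  rw [mul_pow, div_pow, sq_abs] at h
  rw [gap, sub_pos]
  convert! h using 1
  ring

lemma gap_mul_norm_sq_le (ha : ∀ i, 0 < a i) (hb0 : ∀ᵐ x ∂(surf Ω), 0 ≤ b x) (u : H1 Ω) :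
    gap a s * ‖fn u‖ ^ 2 ≤ scalarForm hn hΩ a hb s u u := by
  refine le_trans ?_ (le_scalarForm_self hn hΩ a hb s ha hb0 u)
  have hm := lowerBound_pos hn a ha
  have h := sq_nonneg (lowerBound a * seminormD u - |sc s| * upperBound a / lowerBound a * ‖fn u‖)
  have e : (lowerBound a * seminormD u - |sc s| * upperBound a / lowerBound a * ‖fn u‖) ^ 2 =
      lowerBound a ^ 2 * seminormD u ^ 2 - 2 * |sc s| * upperBound a * seminormD u * ‖fn u‖
        + upperBound a ^ 2 * |sc s| ^ 2 / lowerBound a ^ 2 * ‖fn u‖ ^ 2 := by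
    field_simp
    ring
  rw [e, sq_abs] at h
  rw [gap]
  linarith

lemma gap_mul_seminormD_sq_le (ha : ∀ i, 0 < a i) (hb0 : ∀ᵐ x ∂(surf Ω), 0 ≤ b x) (u : H1 Ω) :
    lowerBound a ^ 2 * gap a s * seminormD u ^ 2 ≤ ‖s‖ ^ 2 * scalarForm hn hΩ a hb s u u := by
  refine le_trans ?_ (mul_le_mul_of_nonneg_left (le_scalarForm_self hn hΩ a hb s ha hb0 u)
    (by positivity))
  have hm := lowerBound_pos hn a ha
  have h := sq_nonneg (‖s‖ ^ 2 * ‖fn u‖ - |sc s| * upperBound a * seminormD u)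
  have e : lowerBound a ^ 2 * gap a s =
      lowerBound a ^ 2 * ‖s‖ ^ 2 - upperBound a ^ 2 * |sc s| ^ 2 := by
    rw [gap, sq_abs]; field_simp
  rw [e]
  nlinarith

lemma coercive_scalarForm (ha : ∀ i, 0 < a i) (hb0 : ∀ᵐ x ∂(surf Ω), 0 ≤ b x)
    (hsa : upperBound a / lowerBound a * |sc s| < ‖s‖) :
    ∃ C, 0 < C ∧ ∀ u, C * ‖u‖ * ‖u‖ ≤ scalarForm hn hΩ a hb s u u := by
  have hm := lowerBound_pos hn a ha
  have hK := gap_pos hn a s ha hsa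
  have hM : 0 ≤ upperBound a := Real.sqrt_nonneg _
  have hs0 : 0 < ‖s‖ := lt_of_le_of_lt (by positivity) hsa
  set c₁ := gap a s
  set c₂ := lowerBound a ^ 2 * gap a s / ‖s‖ ^ 2
  have hc₂ : 0 < c₂ := by positivity
  refine ⟨min c₁ c₂ / 2, by positivity, fun u => ?_⟩
  have h1 := gap_mul_norm_sq_le hn hΩ a hb s ha hb0 u
  have h2 : c₂ * seminormD u ^ 2 ≤ scalarForm hn hΩ a hb s u u := by
    have := gap_mul_seminormD_sq_le hn hΩ a hb s ha hb0 u
    rw [div_mul_eq_mul_div, div_le_iff₀ (by positivity)]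
    linarith
  have h3 : min c₁ c₂ * ‖fn u‖ ^ 2 ≤ c₁ * ‖fn u‖ ^ 2 := by gcongr; exact min_le_left _ _
  have h4 : min c₁ c₂ * seminormD u ^ 2 ≤ c₂ * seminormD u ^ 2 := by
    gcongr; exact min_le_right _ _
  have h5 : ‖u‖ * ‖u‖ = ‖fn u‖ ^ 2 + seminormD u ^ 2 := by
    rw [← pow_two, norm_sq_H1, seminormD_sq]
  rw [mul_assoc, h5]
  linarith

lemma bounds_of_isRobinSolution (ha : ∀ i, 0 < a i) (hb0 : ∀ᵐ x ∂(surf Ω), 0 ≤ b x)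
    (hsa : upperBound a / lowerBound a * |sc s| < ‖s‖) {f : L2 Ω} {u : H1 Ω}
    (hu : ∀ v, scalarForm hn hΩ a hb s u v = inner ℝ f (fn v)) :
    ‖fn u‖ ≤ ‖f‖ / gap a s ∧ seminormD u ≤ ‖s‖ * ‖f‖ / (lowerBound a * gap a s) := by
  have hm := lowerBound_pos hn a ha
  have hK := gap_pos hn a s ha hsa
  have h0 : scalarForm hn hΩ a hb s u u ≤ ‖f‖ * ‖fn u‖ := by
    rw [hu u]; exact real_inner_le_norm _ _
  have h1 := gap_mul_norm_sq_le hn hΩ a hb s ha hb0 u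
  have h2 := gap_mul_seminormD_sq_le hn hΩ a hb s ha hb0 u
  have h3 : gap a s * ‖fn u‖ ≤ ‖f‖ := by
    rcases (norm_nonneg (fn u)).eq_or_lt with h | h
    · rw [← h, mul_zero]; exact norm_nonneg _
    · refine le_of_mul_le_mul_right ?_ h
      calc _ = gap a s * ‖fn u‖ ^ 2 := by ring
        _ ≤ _ := h1.trans h0
  refine ⟨(le_div_iff₀' hK).mpr h3, (le_div_iff₀' (by positivity)).mpr ?_⟩
  refine le_of_sq_le_sq ?_ (by positivity)
  calc (lowerBound a * gap a s * seminormD u) ^ 2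
      = gap a s * (lowerBound a ^ 2 * gap a s * seminormD u ^ 2) := by ring
    _ ≤ gap a s * (‖s‖ ^ 2 * (‖f‖ * ‖fn u‖)) := by
        refine mul_le_mul_of_nonneg_left ?_ hK.le
        exact h2.trans (mul_le_mul_of_nonneg_left h0 (by positivity))
    _ = ‖s‖ ^ 2 * ‖f‖ * (gap a s * ‖fn u‖) := by ring
    _ ≤ ‖s‖ ^ 2 * ‖f‖ * ‖f‖ := by gcongr
    _ = (‖s‖ * ‖f‖) ^ 2 := by ring

end RobinForm

/-- The Lax–Milgram theorem in a complete normed space whose norm satisfies the parallelogram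
law. -/
lemma existsUnique_of_coercive {V : Type*} [NormedAddCommGroup V] [NormedSpace ℝ V]
    [CompleteSpace V] (hV : ∀ x y : V, ‖x + y‖ * ‖x + y‖ + ‖x - y‖ * ‖x - y‖ =
      2 * (‖x‖ * ‖x‖ + ‖y‖ * ‖y‖)) {B : V →L[ℝ] V →L[ℝ] ℝ}
    (hB : ∃ C, 0 < C ∧ ∀ u, C * ‖u‖ * ‖u‖ ≤ B u u) (l : V →L[ℝ] ℝ) :
    ∃! u, ∀ v, B u v = l v := by
  let _ : InnerProductSpace ℝ V := InnerProductSpace.ofNorm ℝ hV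
  have hB' : IsCoercive B := hB
  have e : ∀ u v, B u v = l v ↔ inner ℝ (hB'.continuousLinearEquivOfBilin u) v =
      inner ℝ ((InnerProductSpace.toDual ℝ V).symm l) v := fun u v => by
    rw [IsCoercive.continuousLinearEquivOfBilin_apply, InnerProductSpace.toDual_symm_apply]
  have h : ∀ u, (∀ v, B u v = l v) ↔
      hB'.continuousLinearEquivOfBilin u = (InnerProductSpace.toDual ℝ V).symm l := by
    intro u
    simp_rw [e]
    exact ⟨ext_inner_right ℝ, fun h v => by rw [h]⟩
  simp_rw [h]
  exact hB'.continuousLinearEquivOfBilin.bijective.existsUnique _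

lemma parallelogram_H1 {n : ℕ} {Ω : Set (E n)} (u v : H1 Ω) :
    ‖u + v‖ * ‖u + v‖ + ‖u - v‖ * ‖u - v‖ = 2 * (‖u‖ * ‖u‖ + ‖v‖ * ‖v‖) := by
  simp_rw [← pow_two, norm_sq_H1, fn_add, fn_sub, der_add, der_sub]
  have h : ∀ f g : L2 Ω, ‖f + g‖ ^ 2 + ‖f - g‖ ^ 2 = 2 * (‖f‖ ^ 2 + ‖g‖ ^ 2) := fun f g => by
    simpa only [pow_two] using parallelogram_law_with_norm ℝ f g
  have h1 := h (fn u) (fn v)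
  have h2 := Finset.sum_congr rfl fun i (_ : i ∈ Finset.univ) => h (der u i) (der v i)
  rw [Finset.sum_add_distrib, ← Finset.mul_sum, Finset.sum_add_distrib] at h2
  linarith

end SRobin

end

theorem mainTheorem4 (n : ℕ) (hn : 3 ≤ n)
    (Ω : Set (SRobin.E n)) (hΩ : SRobin.IsMinimallySmooth Ω)
    (a : Fin n → ℝ) (ha : ∀ i, 0 < a i)
    (b : SRobin.E n → ℝ) (hb : MemLp b ∞ (SRobin.surf Ω)) (hb0 : ∀ᵐ x ∂(SRobin.surf Ω), 0 ≤ b x)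
    (s : SRobin.Clif n) (hs : SRobin.IsParavector s)
    (hsa : SRobin.upperBound a / SRobin.lowerBound a * |SRobin.sc s| < ‖s‖)
    (f : SRobin.L2 Ω) :
    (∃! u : SRobin.H1 Ω, SRobin.IsRobinSolution (fun i _ => a i) b s f u) ∧
    ∀ u : SRobin.H1 Ω, SRobin.IsRobinSolution (fun i _ => a i) b s f u →
      ‖SRobin.fn u‖ ≤ ‖f‖ / (‖s‖ ^ 2
        - SRobin.upperBound a ^ 2 * SRobin.sc s ^ 2 / SRobin.lowerBound a ^ 2) ∧
      SRobin.seminormD u ≤ ‖s‖ * ‖f‖ / (SRobin.lowerBound a * (‖s‖ ^ 2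
        - SRobin.upperBound a ^ 2 * SRobin.sc s ^ 2 / SRobin.lowerBound a ^ 2)) := by
  have hn0 : 0 < n := by omega
  have h := SRobin.isRobinSolution_iff hn0 hΩ a hb s f
  have h1 := SRobin.existsUnique_of_coercive SRobin.parallelogram_H1
    (SRobin.coercive_scalarForm hn0 hΩ a hb s ha hb0 hsa) ((innerSL ℝ f).comp (SRobin.fnL Ω))
  obtain ⟨u, hu, huniq⟩ := h1
  refine ⟨⟨u, (h u).mpr hu, fun w hw => huniq w ((h w).mp hw)⟩, fun w hw => ?_⟩
  exact SRobin.bounds_of_isRobinSolution hn0 hΩ a hb s ha hb0 hsa ((h w).mp hw)
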